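/- Let $\theta\in\mathbb R$ be irrational and $\lambda=e^{2\pi i\theta}$. Let $\mathcal O(\mathbb T^2_\theta)$ be the complex $*$-algebra generated by unitaries $V,W$ subject to $VW=\lambda WV$, let $\sigma$ be its algebra automorphism with $\sigma(V)=V^*$, $\sigma(W)=W^*$, and put $\mathcal O(\mathbb T^2_\theta)_\pm=\{a:\sigma(a)=\pm a\}$. The noncommutative pillow algebra is $\mathcal O(\mathbb P_\theta)=\mathcal O(\mathbb T^2_\theta)_+$. Let $\partial_V,\partial_W$ be the derivations of $\mathcal O(\mathbb T^2_\theta)$ with $\partial_V(V^mW^n)=im\,V^mW^n$ and $\partial_W(V^mW^n)=in\,V^mW^n$ for $m,n\in\mathbb Z$. Let $\Omega(\mathbb P_\theta)$ be the differential graded algebra with $$\Omega^0=\mathcal O(\mathbb P_\theta),\quad \Omega^1=\mathcal O(\mathbb T^2_\theta)_-\oplus\mathcal O(\mathbb T^2_\theta)_-,\quad \Omega^2=\mathcal O(\mathbb P_\theta),\quad \Omega^n=0\ (n>2),$$ whose product is $(a_1,a_2)\wedge(a_3,a_4)=a_1a_4-a_2a_3$ on $\Omega^1$ and the (componentwise)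 multiplication of $\mathcal O(\mathbb T^2_\theta)$ whenever one factor lies in $\Omega^0$, and whose differential is $da=(\partial_V a,\partial_W a)$ on $\Omega^0$ and $d(a_1,a_2)=\partial_V a_2-\partial_W a_1$ on $\Omega^1$. Definitions. Let $A$ be a $\mathbb C$-algebra. A differential graded algebra $(\Omega,d)$ with $\Omega^0=A$ is a *calculus* over $A$ if $\Omega^n=A\,dA\wedge\cdots\wedge dA$ ($n$ factors $dA$) for all $n\ge 0$; it is *connected* if $\ker d|_A=\mathbb C\cdot 1$, and has *dimension* $n$ if $\Omega^n\ne0$ and $\Omega^m=0$ for $m>n$. Let $\mathcal I_n$ be the space of right $A$-linear maps $\Omega^n\to A$, an $A$-bimodule by $(a\cdot\phi\cdot b)(\omega)=a\phi(b\omega)$; for $\phi\in\mathcal I_{n+m}$ and $\omega\in\Omega^n$ let $\phi\cdot\omega\in\mathcal I_m$ be $(\phi\cdot\omega)(\omega')=\phi(\omega\wedge\omega')$. A *divergence* is a linear map $\nabla:\mathcal I_1\to A$ with $\nabla(\phi\cdot a)=\nabla(\phi)a+\phi(da)$; it extends to $\nabla_n:\mathcal I_{n+1}\to\mathcal I_n$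 by $\nabla_n(\phi)(\omega)=\nabla(\phi\cdot\omega)+(-1)^{n+1}\phi(d\omega)$ (with $\nabla_0=\nabla$ under $\mathcal I_0\cong A$), and is *flat* if $\nabla\circ\nabla_1=0$. An $n$-dimensional calculus is *integrable* if there are a flat divergence $\nabla$, an algebra automorphism $\nu$ of $A$ and linear bijections $\Theta_k:\Omega^k\to\mathcal I_{n-k}$ ($0\le k\le n$) such that $\Theta_k(a\omega b)=\nu(a)\cdot\Theta_k(\omega)\cdot b$ for all $a,b\in A$, $\omega\in\Omega^k$, and $\Theta_{k+1}\circ d=\nabla_{n-k-1}\circ\Theta_k$ for $0\le k<n$. For a finitely generated algebra $A$ with finite-dimensional generating subspace $\mathcal V$, let $\mathcal V(n)$ be the span of $1$ and all words of length at most $n$ in elements of $\mathcal V$; then $\operatorname{GKdim}A=\inf\{\nu\in\mathbb R:\dim\mathcal V(n)\le n^\nu\text{ for all large }n\}$, which does not depend on $\mathcal V$. A finitely generated algebra of integer Gelfand–Kirillov dimension $n$ is *differentially smooth* if it admits an $n$-dimensional connected integrable calculus. **Theorem 3.2.** $\Omega(\mathbb P_\theta)$ is a two-dimensional connected integrable differential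 calculus over $\mathcal O(\mathbb P_\theta)$. The algebra $\mathcal O(\mathbb P_\theta)$ is finitely generated of Gelfand–Kirillov dimension $2$ and hence is differentially smooth. -/

import Mathlib

open Filter

universe u

/-- A differential graded algebra `Ω = ⨁ₙ Ωⁿ` over a field `k`, together with an identification
`ι` of `Ω⁰` with a given algebra `A`. The product of `Ω` is the wedge product. -/
structure DGAlgebraOver (k : Type u) [Field k] (A : Type u) [Ring A] [Algebra k A] where
  /-- the total space -/
  Form : Type u
  [ring : Ring Form]
  [algebra : Algebra k Form]
  /-- the component of degree `n` -/
  grade : ℕ → Submodule k Form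
  [gradedMonoid : SetLike.GradedMonoid grade]
  isInternal : DirectSum.IsInternal grade
  /-- the differential -/
  d : Form →ₗ[k] Form
  d_mem : ∀ {n : ℕ} {x : Form}, x ∈ grade n → d x ∈ grade (n + 1)
  leibniz : ∀ {n : ℕ} {x : Form} (y : Form), x ∈ grade n →
    d (x * y) = d x * y + (-1) ^ n * (x * d y)
  d_d : ∀ x : Form, d (d x) = 0
  /-- the identification of `A` with `Ω⁰` -/
  ι : A →ₐ[k] Form
  ι_injective : Function.Injective ι
  range_ι : LinearMap.range ι.toLinearMap = grade 0

namespace DGAlgebraOver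

attribute [instance] DGAlgebraOver.ring DGAlgebraOver.algebra DGAlgebraOver.gradedMonoid

variable {k : Type u} [Field k] {A : Type u} [Ring A] [Algebra k A] (Ω : DGAlgebraOver k A)

theorem ι_mem (a : A) : Ω.ι a ∈ Ω.grade 0 := by
  rw [← Ω.range_ι]; exact ⟨a, rfl⟩

/-- `Ω` is a (differential) calculus over `A`: `Ωⁿ = A dA ∧ ⋯ ∧ dA` with `n` factors `dA`. -/
def IsCalculus : Prop :=
  ∀ n : ℕ, Ω.grade n = Ω.grade 0 * ((Ω.grade 0).map Ω.d) ^ n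

/-- The kernel of `d` restricted to `A` is `k · 1`. -/
def IsConnected : Prop :=
  ∀ a : A, Ω.d (Ω.ι a) = 0 ↔ ∃ c : k, a = algebraMap k A c

/-- `Ωⁿ ≠ 0` and `Ωᵐ = 0` for `m > n`. -/
def HasDimension (n : ℕ) : Prop :=
  Ω.grade n ≠ ⊥ ∧ ∀ m : ℕ, n < m → Ω.grade m = ⊥

variable {Ω}

/-- The left action of `A` on `Ωⁿ`. -/
def lmul {n : ℕ} (a : A) (ω : Ω.grade n) : Ω.grade n :=
  ⟨Ω.ι a * ω, by simpa using SetLike.mul_mem_graded (Ω.ι_mem a) ω.2⟩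

/-- The right action of `A` on `Ωⁿ`. -/
def rmul {n : ℕ} (ω : Ω.grade n) (a : A) : Ω.grade n :=
  ⟨ω * Ω.ι a, by simpa using SetLike.mul_mem_graded ω.2 (Ω.ι_mem a)⟩

/-- The wedge product `Ωᵐ × Ωⁿ → Ωᵐ⁺ⁿ`. -/
def wedge {m n : ℕ} (ω : Ω.grade m) (ω' : Ω.grade n) : Ω.grade (m + n) :=
  ⟨ω * ω', SetLike.mul_mem_graded ω.2 ω'.2⟩

variable (Ω)

/-- The differential `Ωⁿ → Ωⁿ⁺¹`. -/
def dGrade (n : ℕ) : Ω.grade n →ₗ[k] Ω.grade (n + 1) :=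
  Ω.d.restrict fun _ hx => Ω.d_mem hx

/-- The differential `A → Ω¹`. -/
def dZero (a : A) : Ω.grade 1 := ⟨Ω.d (Ω.ι a), Ω.d_mem (Ω.ι_mem a)⟩

/-- The space `ℐₙ A` of right `A`-linear maps `Ωⁿ → A`. -/
def IntegralForm (n : ℕ) : Submodule k (Ω.grade n →ₗ[k] A) where
  carrier := {φ | ∀ (ω : Ω.grade n) (a : A), φ (rmul ω a) = φ ω * a}
  add_mem' {φ ψ} hφ hψ := by
    intro ω a
    simp only [Set.mem_ofPred_eq] at hφ hψ
    simp [hφ, hψ, add_mul]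
  zero_mem' := by intro ω a; simp
  smul_mem' c φ hφ := by
    intro ω a
    simp only [Set.mem_ofPred_eq] at hφ
    simp [hφ]

variable {Ω}

/-- `(a · φ)(ω) = a φ(ω)`. -/
def leftAct {n : ℕ} (a : A) (φ : Ω.IntegralForm n) : Ω.IntegralForm n :=
  ⟨(LinearMap.mulLeft k a).comp φ.1, fun ω b => by
    simp [φ.2 ω b, mul_assoc]⟩

/-- `(φ · b)(ω) = φ(b ω)`. -/
def rightAct {n : ℕ} (φ : Ω.IntegralForm n) (b : A) : Ω.IntegralForm n :=
  ⟨{ toFun := fun ω => φ.1 (lmul b ω)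
     map_add' := fun x y => by
      rw [← map_add]; congr 1; ext; simp [lmul, mul_add]
     map_smul' := fun c x => by
      rw [RingHom.id_apply, ← map_smul]; congr 1; ext; simp [lmul] },
    fun ω a => by
      have h := φ.2 (lmul b ω) a
      rw [LinearMap.coe_mk, AddHom.coe_mk, ← h]
      congr 1; ext; simp [lmul, rmul, mul_assoc]⟩

/-- `(φ · ω)(ω') = φ(ω ∧ ω')` for `φ ∈ ℐₙ₊ₘ A`, `ω ∈ Ωⁿ`, `ω' ∈ Ωᵐ`. -/
def formAct {n m : ℕ} (φ : Ω.IntegralForm (n + m)) (ω : Ω.grade n) : Ω.IntegralForm m :=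
  ⟨{ toFun := fun ω' => φ.1 (wedge ω ω')
     map_add' := fun x y => by
      rw [← map_add]; congr 1; ext; simp [wedge, mul_add]
     map_smul' := fun c x => by
      rw [RingHom.id_apply, ← map_smul]; congr 1; ext; simp [wedge] },
    fun ω' a => by
      have h := φ.2 (wedge ω ω') a
      rw [LinearMap.coe_mk, AddHom.coe_mk, ← h]
      congr 1; ext; simp [wedge, rmul, mul_assoc]⟩

variable (Ω)

/-- A divergence: a linear map `∇ : ℐ₁ A → A` with `∇(φ · a) = ∇(φ) a + φ(da)`. -/
structure Divergence where
  toLin : Ω.IntegralForm 1 →ₗ[k] A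
  leibniz : ∀ (φ : Ω.IntegralForm 1) (a : A),
    toLin (rightAct φ a) = toLin φ * a + φ.1 (Ω.dZero a)

variable {Ω}

/-- The extension `∇ₙ : ℐₙ₊₁ A → ℐₙ A`,
`∇ₙ(φ)(ω) = ∇(φ · ω) + (-1)ⁿ⁺¹ φ(dω)`. -/
def Divergence.ext (D : Ω.Divergence) (n : ℕ) (φ : Ω.IntegralForm (n + 1)) :
    Ω.IntegralForm n :=
  ⟨{ toFun := fun ω => D.toLin (formAct φ ω) + (-1) ^ (n + 1) * φ.1 (Ω.dGrade n ω)
     map_add' := fun x y => by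
      have h : formAct φ (x + y) = formAct φ x + formAct φ y := by
        ext ω'
        change φ.1 _ = φ.1 _ + φ.1 _
        rw [← map_add]; congr 1; ext; simp [wedge, add_mul]
      rw [h, map_add, map_add, map_add, mul_add]; abel
     map_smul' := fun c x => by
      have h : formAct φ (c • x) = c • formAct φ x := by
        ext ω'
        change φ.1 _ = c • φ.1 _
        rw [← map_smul]; congr 1; ext; simp [wedge]
      rw [h, map_smul, map_smul, map_smul, RingHom.id_apply, smul_add, mul_smul_comm] },
    fun ω a => by
      have h : formAct φ (rmul ω a) = rightAct (formAct φ ω) a := by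
        ext ω'
        change φ.1 _ = φ.1 _
        congr 1; ext; simp [wedge, rmul, lmul, mul_assoc]
      have h2 : Ω.dGrade n (rmul ω a)
          = rmul (Ω.dGrade n ω) a + (-1 : k) ^ n • wedge ω (Ω.dZero a) := by
        ext
        change Ω.d (ω.1 * Ω.ι a) = Ω.d ω.1 * Ω.ι a + (-1 : k) ^ n • (ω.1 * Ω.d (Ω.ι a))
        rw [Ω.leibniz _ ω.2]
        rcases neg_one_pow_eq_or k n with hn | hn <;>
          rcases Nat.even_or_odd n with he | he <;> simp [he.neg_one_pow]
      have h3 : (formAct φ ω).1 (Ω.dZero a) = φ.1 (wedge ω (Ω.dZero a)) := rfl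
      rw [LinearMap.coe_mk, AddHom.coe_mk, h, D.leibniz, h3, h2, map_add, map_smul, φ.2]
      rcases Nat.even_or_odd n with he | he <;>
        simp [he.neg_one_pow, pow_succ, add_mul] ; abel⟩

/-- `∇ ∘ ∇₁ = 0`. -/
def Divergence.IsFlat (D : Ω.Divergence) : Prop :=
  ∀ φ : Ω.IntegralForm 2, D.toLin (D.ext 1 φ) = 0

variable (Ω)

/-- Integrability of an `n`-dimensional calculus: there are a flat divergence `∇`, an algebra
automorphism `ν` of `A` and `A`-bimodule isomorphisms `Θₖ : Ωᵏ → ^ν ℐₙ₋ₖ A`, `k = 0, …, n`, which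
intertwine `d` with the maps `∇ₗ`. Here `l = n - k`. The algebra `A` at the right end of the
complex of integral forms is identified with `ℐ₀ A` by `a ↦ (b ↦ a b)`, under which `∇` becomes
`∇₀` (see `Divergence.ext_zero_apply`). -/
def IsIntegrable (n : ℕ) : Prop :=
  ∃ (D : Ω.Divergence) (ν : A ≃ₐ[k] A)
    (Θ : ∀ i l : ℕ, i + l = n → (Ω.grade i ≃ₗ[k] Ω.IntegralForm l)),
    D.IsFlat ∧
    (∀ (i l : ℕ) (h : i + l = n) (a b : A) (ω : Ω.grade i),
      Θ i l h (lmul a (rmul ω b)) = leftAct (ν a) (rightAct (Θ i l h ω) b)) ∧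
    (∀ (i l : ℕ) (h : i + (l + 1) = n) (ω : Ω.grade i),
      Θ (i + 1) l (by omega) (Ω.dGrade i ω) = D.ext l (Θ i (l + 1) h ω))

variable {Ω}

theorem Divergence.ext_zero_apply (D : Ω.Divergence) (φ : Ω.IntegralForm 1) (a : A) :
    (D.ext 0 φ).1 ⟨Ω.ι a, Ω.ι_mem a⟩ = D.toLin φ * a := by
  have h : formAct (n := 0) (m := 1) φ ⟨Ω.ι a, Ω.ι_mem a⟩ = rightAct φ a := rfl
  change D.toLin (formAct (n := 0) (m := 1) φ ⟨Ω.ι a, Ω.ι_mem a⟩)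
    + (-1) ^ (0 + 1) * φ.1 (Ω.dZero a) = _
  rw [h, D.leibniz]
  simp

end DGAlgebraOver

section Growth

variable (k : Type u) [Field k] {A : Type u} [Ring A] [Algebra k A]

/-- `inf {ν ∈ ℝ | dim V(n) ≤ n^ν for all large n}` (which is `⊤` if there is no such `ν`), where
`V(n) = (k 1 + V)ⁿ` is the span of the words of length at most `n` in elements of `V`. -/
noncomputable def growthExponent (V : Submodule k A) : EReal :=
  sInf ((fun ν : ℝ => (ν : EReal)) ''
    {ν : ℝ | ∀ᶠ n : ℕ in atTop,
      (Module.finrank k ((1 ⊔ V) ^ n : Submodule k A) : ℝ) ≤ (n : ℝ) ^ ν})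

variable (A)

/-- `A` is an affine (finitely generated) algebra of Gelfand-Kirillov dimension `n`, computed from
any finite-dimensional generating subspace. -/
def IsAffineOfGKDim (n : ℕ) : Prop :=
  Algebra.FiniteType k A ∧
    ∀ V : Submodule k A, FiniteDimensional k V → Algebra.adjoin k (V : Set A) = ⊤ →
      growthExponent k V = ((n : ℝ) : EReal)

/-- An affine algebra of integer Gelfand-Kirillov dimension `n` is differentially smooth if it
admits an `n`-dimensional connected integrable differential calculus. -/
def IsDifferentiallySmooth : Prop :=
  ∃ n : ℕ, IsAffineOfGKDim k A n ∧
    ∃ Ω : DGAlgebraOver k A,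
      Ω.IsCalculus ∧ Ω.HasDimension n ∧ Ω.IsConnected ∧ Ω.IsIntegrable n

end Growth

/-! ### The noncommutative torus -/

/-- Generators `V, V*, W, W*`. -/
inductive TorusGen : Type
  | V | Vs | W | Ws

/-- `λ = exp(2πiθ)`. -/
noncomputable def torusParam (θ : ℝ) : ℂ := Complex.exp (2 * Real.pi * Complex.I * θ)

/-- `V` and `W` are unitary and `VW = λWV`. (The adjoint relation `W*V* = λ̄V*W*` follows.) -/
inductive TorusRel (θ : ℝ) : FreeAlgebra ℂ TorusGen → FreeAlgebra ℂ TorusGen → Prop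
  | V_Vs : TorusRel θ (FreeAlgebra.ι ℂ .V * FreeAlgebra.ι ℂ .Vs) 1
  | Vs_V : TorusRel θ (FreeAlgebra.ι ℂ .Vs * FreeAlgebra.ι ℂ .V) 1
  | W_Ws : TorusRel θ (FreeAlgebra.ι ℂ .W * FreeAlgebra.ι ℂ .Ws) 1
  | Ws_W : TorusRel θ (FreeAlgebra.ι ℂ .Ws * FreeAlgebra.ι ℂ .W) 1
  | V_W : TorusRel θ (FreeAlgebra.ι ℂ .V * FreeAlgebra.ι ℂ .W)
      (torusParam θ • (FreeAlgebra.ι ℂ .W * FreeAlgebra.ι ℂ .V))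

/-- The coordinate algebra `𝒪(𝕋²_θ)` of the noncommutative torus. -/
def Torus (θ : ℝ) : Type := RingQuot (TorusRel θ)

namespace Torus

noncomputable instance (θ : ℝ) : Ring (Torus θ) := inferInstanceAs (Ring (RingQuot (TorusRel θ)))

noncomputable instance (θ : ℝ) : Algebra ℂ (Torus θ) :=
  inferInstanceAs (Algebra ℂ (RingQuot (TorusRel θ)))

variable {θ : ℝ}

/-- The images of the generators. -/
noncomputable def gen (g : TorusGen) : Torus θ :=
  RingQuot.mkAlgHom ℂ (TorusRel θ) (FreeAlgebra.ι ℂ g)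

theorem V_Vs : (gen .V * gen .Vs : Torus θ) = 1 := by
  have h := RingQuot.mkAlgHom_rel ℂ (TorusRel.V_Vs (θ := θ))
  rwa [map_mul, map_one] at h

theorem Vs_V : (gen .Vs * gen .V : Torus θ) = 1 := by
  have h := RingQuot.mkAlgHom_rel ℂ (TorusRel.Vs_V (θ := θ))
  rwa [map_mul, map_one] at h

theorem W_Ws : (gen .W * gen .Ws : Torus θ) = 1 := by
  have h := RingQuot.mkAlgHom_rel ℂ (TorusRel.W_Ws (θ := θ))
  rwa [map_mul, map_one] at h

theorem Ws_W : (gen .Ws * gen .W : Torus θ) = 1 := by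
  have h := RingQuot.mkAlgHom_rel ℂ (TorusRel.Ws_W (θ := θ))
  rwa [map_mul, map_one] at h

theorem V_W : (gen .V * gen .W : Torus θ) = torusParam θ • (gen .W * gen .V) := by
  have h := RingQuot.mkAlgHom_rel ℂ (TorusRel.V_W (θ := θ))
  rwa [map_mul, map_smul, map_mul] at h

theorem Vs_Ws : (gen .Vs * gen .Ws : Torus θ) = torusParam θ • (gen .Ws * gen .Vs) := by
  have h := congrArg (fun t : Torus θ => gen .Ws * gen .Vs * t * (gen .Vs * gen .Ws))
    (V_W (θ := θ))
  have e1 : (gen .Ws * gen .Vs * (gen .V * gen .W) * (gen .Vs * gen .Ws) : Torus θ)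
      = gen .Vs * gen .Ws := by
    calc _ = (gen .Ws * (gen .Vs * gen .V) * gen .W * (gen .Vs * gen .Ws) : Torus θ) := by
          noncomm_ring
      _ = gen .Vs * gen .Ws := by rw [Vs_V, mul_one, Ws_W, one_mul]
  have e2 : (gen .Ws * gen .Vs * (gen .W * gen .V) * (gen .Vs * gen .Ws) : Torus θ)
      = gen .Ws * gen .Vs := by
    calc _ = (gen .Ws * gen .Vs * (gen .W * (gen .V * gen .Vs) * gen .Ws) : Torus θ) := by
          noncomm_ring
      _ = gen .Ws * gen .Vs := by rw [V_Vs, mul_one, W_Ws, mul_one]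
  simpa only [mul_smul_comm, smul_mul_assoc, e1, e2] using h

/-- Algebra maps out of `𝒪(𝕋²_θ)`. -/
noncomputable def lift {B : Type*} [Ring B] [Algebra ℂ B] (f : TorusGen → B)
    (h1 : f .V * f .Vs = 1) (h2 : f .Vs * f .V = 1) (h3 : f .W * f .Ws = 1)
    (h4 : f .Ws * f .W = 1) (h5 : f .V * f .W = torusParam θ • (f .W * f .V)) :
    Torus θ →ₐ[ℂ] B :=
  RingQuot.liftAlgHom ℂ ⟨FreeAlgebra.lift ℂ f, by
    intro x y h
    cases h <;> simp [h1, h2, h3, h4, h5]⟩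

@[simp]
theorem lift_gen {B : Type*} [Ring B] [Algebra ℂ B] (f : TorusGen → B) (h1 h2 h3 h4 h5)
    (g : TorusGen) : lift (θ := θ) f h1 h2 h3 h4 h5 (gen g) = f g := by
  unfold lift gen
  exact (RingQuot.liftAlgHom_mkAlgHom_apply ℂ _ _ _).trans (by simp)

@[elab_as_elim]
theorem induction {P : Torus θ → Prop} (halg : ∀ c : ℂ, P (algebraMap ℂ _ c))
    (hgen : ∀ g, P (gen g)) (hmul : ∀ a b, P a → P b → P (a * b))
    (hadd : ∀ a b, P a → P b → P (a + b)) (a : Torus θ) : P a := by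
  obtain ⟨x, rfl⟩ := RingQuot.mkAlgHom_surjective ℂ (TorusRel θ) a
  induction x using FreeAlgebra.induction with
  | grade0 c => rw [AlgHom.commutes]; exact halg c
  | grade1 g => exact hgen g
  | mul a b ha hb => rw [map_mul]; exact hmul _ _ ha hb
  | add a b ha hb => rw [map_add]; exact hadd _ _ ha hb

/-- The algebra automorphism `σ`, `V ↦ V*`, `W ↦ W*`. -/
noncomputable def sigma : Torus θ →ₐ[ℂ] Torus θ :=
  lift (fun
    | .V => gen .Vs
    | .Vs => gen .V
    | .W => gen .Ws
    | .Ws => gen .W) Vs_V V_Vs Ws_W W_Ws Vs_Ws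

/-- `a ↦ a + ε ∂(a)`, where `∂` is the derivation with `∂(V) = p V`, `∂(W) = q W`. -/
noncomputable def derHom (p q : ℂ) : Torus θ →ₐ[ℂ] TrivSqZeroExt (Torus θ) (Torus θ) :=
  lift (fun
    | .V => TrivSqZeroExt.inl (gen .V) + TrivSqZeroExt.inr (p • gen .V)
    | .Vs => TrivSqZeroExt.inl (gen .Vs) + TrivSqZeroExt.inr (-(p • gen .Vs))
    | .W => TrivSqZeroExt.inl (gen .W) + TrivSqZeroExt.inr (q • gen .W)
    | .Ws => TrivSqZeroExt.inl (gen .Ws) + TrivSqZeroExt.inr (-(q • gen .Ws)))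
    (by ext <;> simp [V_Vs])
    (by ext <;> simp [Vs_V])
    (by ext <;> simp [W_Ws])
    (by ext <;> simp [Ws_W])
    (by
      ext
      · simp [V_W]
      · simp only [TrivSqZeroExt.snd_mul, TrivSqZeroExt.snd_smul, TrivSqZeroExt.fst_add,
          TrivSqZeroExt.snd_add, TrivSqZeroExt.fst_inl, TrivSqZeroExt.snd_inl,
          TrivSqZeroExt.fst_inr, TrivSqZeroExt.snd_inr, add_zero, zero_add, smul_eq_mul,
          MulOpposite.smul_eq_mul_unop, MulOpposite.unop_op, mul_smul_comm, smul_mul_assoc, V_W]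
        module)

/-- The derivation `∂` of `𝒪(𝕋²_θ)` with `∂(V) = p V`, `∂(W) = q W`. -/
noncomputable def der (p q : ℂ) : Torus θ →ₗ[ℂ] Torus θ :=
  (TrivSqZeroExt.sndHom (Torus θ) (Torus θ) |>.restrictScalars ℂ).comp (derHom p q).toLinearMap

theorem der_def (p q : ℂ) (a : Torus θ) : der p q a = (derHom p q a).snd := rfl

theorem derHom_fst (p q : ℂ) (a : Torus θ) : (derHom p q a).fst = a := by
  induction a using Torus.induction with
  | halg c => rw [AlgHom.commutes]; rfl
  | hgen g => rw [derHom, lift_gen]; cases g <;> simp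
  | hmul a b ha hb => rw [map_mul, TrivSqZeroExt.fst_mul, ha, hb]
  | hadd a b ha hb => rw [map_add, TrivSqZeroExt.fst_add, ha, hb]

theorem der_mul (p q : ℂ) (a b : Torus θ) :
    der p q (a * b) = der p q a * b + a * der p q b := by
  simp only [der_def]
  rw [map_mul, TrivSqZeroExt.snd_mul, derHom_fst, derHom_fst, add_comm]
  simp [MulOpposite.smul_eq_mul_unop]

theorem der_algebraMap (p q c : ℂ) : der p q (algebraMap ℂ (Torus θ) c) = 0 := by
  rw [der_def, AlgHom.commutes]; rfl

/-- `∂_V`, with `∂_V(VᵐWⁿ) = i m VᵐWⁿ`. -/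
noncomputable def derV : Torus θ →ₗ[ℂ] Torus θ := der Complex.I 0

/-- `∂_W`, with `∂_W(VᵐWⁿ) = i n VᵐWⁿ`. -/
noncomputable def derW : Torus θ →ₗ[ℂ] Torus θ := der 0 Complex.I

/-- The unitary `V`. -/
noncomputable def unitV : (Torus θ)ˣ := ⟨gen .V, gen .Vs, V_Vs, Vs_V⟩

/-- The unitary `W`. -/
noncomputable def unitW : (Torus θ)ˣ := ⟨gen .W, gen .Ws, W_Ws, Ws_W⟩

theorem der_gen (p q : ℂ) (g : TorusGen) :
    der p q (gen g : Torus θ) = (match g with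
      | .V => p
      | .Vs => -p
      | .W => q
      | .Ws => -q) • gen g := by
  rw [der_def, derHom, lift_gen]
  cases g <;> simp

theorem der_unit_zpow (p q c : ℂ) (u : (Torus θ)ˣ) (hu : der p q (u : Torus θ) = c • (u : Torus θ))
    (hu' : der p q ((u⁻¹ : (Torus θ)ˣ) : Torus θ) = (-c) • ((u⁻¹ : (Torus θ)ˣ) : Torus θ))
    (m : ℤ) : der p q ((u ^ m : (Torus θ)ˣ) : Torus θ) = (m * c) • ((u ^ m : (Torus θ)ˣ) : Torus θ) := by
  induction m with
  | zero =>
    simpa using der_algebraMap (θ := θ) p q 1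
  | succ n ih =>
    rw [zpow_add_one, Units.val_mul, der_mul, ih, hu, smul_mul_assoc, mul_smul_comm, ← add_smul]
    congr 1; push_cast; ring
  | pred n ih =>
    rw [zpow_sub_one, Units.val_mul, der_mul, ih, hu', smul_mul_assoc, mul_smul_comm, ← add_smul]
    congr 1; push_cast; ring

theorem der_monomial (p q : ℂ) (m n : ℤ) :
    der p q ((unitV ^ m * unitW ^ n : (Torus θ)ˣ) : Torus θ)
      = (m * p + n * q) • ((unitV ^ m * unitW ^ n : (Torus θ)ˣ) : Torus θ) := by
  rw [Units.val_mul, der_mul, der_unit_zpow p q p unitV (der_gen p q .V) (der_gen p q .Vs),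
    der_unit_zpow p q q unitW (der_gen p q .W) (der_gen p q .Ws), smul_mul_assoc, mul_smul_comm,
    ← add_smul]

theorem derV_monomial (m n : ℤ) :
    derV ((unitV ^ m * unitW ^ n : (Torus θ)ˣ) : Torus θ)
      = (Complex.I * m) • ((unitV ^ m * unitW ^ n : (Torus θ)ˣ) : Torus θ) := by
  rw [derV, der_monomial]; congr 1; ring

theorem derW_monomial (m n : ℤ) :
    derW ((unitV ^ m * unitW ^ n : (Torus θ)ˣ) : Torus θ)
      = (Complex.I * n) • ((unitV ^ m * unitW ^ n : (Torus θ)ˣ) : Torus θ) := by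
  rw [derW, der_monomial]; congr 1; ring

theorem der_comm (p q p' q' : ℂ) (a : Torus θ) :
    der p q (der p' q' a) = der p' q' (der p q a) := by
  induction a using Torus.induction with
  | halg c => simp [der_algebraMap]
  | hgen g => cases g <;> simp only [der_gen, map_smul, smul_smul, mul_comm]
  | hmul a b ha hb => simp only [der_mul, map_add, ha, hb]; abel
  | hadd a b ha hb => simp only [map_add, ha, hb]

theorem der_sigma (p q : ℂ) (a : Torus θ) : der p q (sigma a) = -sigma (der p q a) := by
  induction a using Torus.induction with
  | halg c => simp [der_algebraMap]
  | hgen g => cases g <;> simp [sigma, der_gen]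
  | hmul a b ha hb => simp only [der_mul, map_mul, map_add, ha, hb]; noncomm_ring
  | hadd a b ha hb => simp only [map_add, ha, hb]; abel

end Torus

/-! ### The noncommutative pillow and its calculus -/

/-- `𝒪(ℙ_θ) = 𝒪(𝕋²_θ)₊`, the algebra of `σ`-invariant elements. -/
noncomputable def Pillow (θ : ℝ) : Subalgebra ℂ (Torus θ) :=
  AlgHom.equalizer Torus.sigma (AlgHom.id ℂ (Torus θ))

/-- `𝒪(𝕋²_θ)₋`, the space of all `a` with `σ(a) = -a`. -/
noncomputable def Minus (θ : ℝ) : Submodule ℂ (Torus θ) :=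
  LinearMap.eqLocus Torus.sigma.toLinearMap (-LinearMap.id)

theorem mem_pillow {θ : ℝ} {a : Torus θ} : a ∈ Pillow θ ↔ Torus.sigma a = a := Iff.rfl

theorem mem_minus {θ : ℝ} {a : Torus θ} : a ∈ Minus θ ↔ Torus.sigma a = -a := Iff.rfl

/-- The total space `Ω(ℙ_θ) = Ω⁰ ⊕ Ω¹ ⊕ Ω²`, where `Ω⁰ = 𝒪(ℙ_θ)`,
`Ω¹ = 𝒪(𝕋²_θ)₋ ⊕ 𝒪(𝕋²_θ)₋` and `Ω² = 𝒪(ℙ_θ)`. -/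
def PillowForm (θ : ℝ) : Type := Pillow θ × (Minus θ × Minus θ) × Pillow θ

namespace PillowForm

variable {θ : ℝ}

noncomputable instance : AddCommGroup (PillowForm θ) :=
  inferInstanceAs (AddCommGroup (Pillow θ × (Minus θ × Minus θ) × Pillow θ))

noncomputable instance : Module ℂ (PillowForm θ) :=
  inferInstanceAs (Module ℂ (Pillow θ × (Minus θ × Minus θ) × Pillow θ))

/-- The component in `Ω⁰`. -/
def f0 (x : PillowForm θ) : Torus θ := x.1

/-- The first component in `Ω¹`. -/
def fV (x : PillowForm θ) : Torus θ := x.2.1.1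

/-- The second component in `Ω¹`. -/
def fW (x : PillowForm θ) : Torus θ := x.2.1.2

/-- The component in `Ω²`. -/
def f2 (x : PillowForm θ) : Torus θ := x.2.2

theorem sigma_f0 (x : PillowForm θ) : Torus.sigma x.f0 = x.f0 := x.1.2
theorem sigma_fV (x : PillowForm θ) : Torus.sigma x.fV = -x.fV := x.2.1.1.2
theorem sigma_fW (x : PillowForm θ) : Torus.sigma x.fW = -x.fW := x.2.1.2.2
theorem sigma_f2 (x : PillowForm θ) : Torus.sigma x.f2 = x.f2 := x.2.2.2

@[ext]
theorem ext {x y : PillowForm θ} (h0 : x.f0 = y.f0) (hV : x.fV = y.fV) (hW : x.fW = y.fW)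
    (h2 : x.f2 = y.f2) : x = y :=
  Prod.ext (Subtype.ext h0)
    (Prod.ext (Prod.ext (Subtype.ext hV) (Subtype.ext hW)) (Subtype.ext h2))

/-- The form with components `a ∈ Ω⁰`, `(b, c) ∈ Ω¹`, `e ∈ Ω²`. -/
def mk (a b c e : Torus θ) (ha : Torus.sigma a = a) (hb : Torus.sigma b = -b)
    (hc : Torus.sigma c = -c) (he : Torus.sigma e = e) : PillowForm θ :=
  (⟨a, ha⟩, (⟨b, hb⟩, ⟨c, hc⟩), ⟨e, he⟩)

section mk
variable (a b c e : Torus θ) (ha hb hc he)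
@[simp] theorem f0_mk : (mk a b c e ha hb hc he).f0 = a := rfl
@[simp] theorem fV_mk : (mk a b c e ha hb hc he).fV = b := rfl
@[simp] theorem fW_mk : (mk a b c e ha hb hc he).fW = c := rfl
@[simp] theorem f2_mk : (mk a b c e ha hb hc he).f2 = e := rfl
end mk

section add
variable (x y : PillowForm θ) (c : ℂ)
@[simp] theorem f0_add : (x + y).f0 = x.f0 + y.f0 := rfl
@[simp] theorem fV_add : (x + y).fV = x.fV + y.fV := rfl
@[simp] theorem fW_add : (x + y).fW = x.fW + y.fW := rfl
@[simp] theorem f2_add : (x + y).f2 = x.f2 + y.f2 := rfl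
@[simp] theorem f0_smul : (c • x).f0 = c • x.f0 := rfl
@[simp] theorem fV_smul : (c • x).fV = c • x.fV := rfl
@[simp] theorem fW_smul : (c • x).fW = c • x.fW := rfl
@[simp] theorem f2_smul : (c • x).f2 = c • x.f2 := rfl
@[simp] theorem f0_neg : (-x).f0 = -x.f0 := rfl
@[simp] theorem fV_neg : (-x).fV = -x.fV := rfl
@[simp] theorem fW_neg : (-x).fW = -x.fW := rfl
@[simp] theorem f2_neg : (-x).f2 = -x.f2 := rfl
@[simp] theorem f0_zero : (0 : PillowForm θ).f0 = 0 := rfl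
@[simp] theorem fV_zero : (0 : PillowForm θ).fV = 0 := rfl
@[simp] theorem fW_zero : (0 : PillowForm θ).fW = 0 := rfl
@[simp] theorem f2_zero : (0 : PillowForm θ).f2 = 0 := rfl
end add

noncomputable instance : One (PillowForm θ) :=
  ⟨mk 1 0 0 0 (by simp) (by simp) (by simp) (by simp)⟩

/-- The wedge product: the product of the torus algebra in each slot, with
`(a₁, a₂) ∧ (a₃, a₄) = a₁ a₄ - a₂ a₃` on `Ω¹`. -/
noncomputable instance : Mul (PillowForm θ) :=
  ⟨fun x y => mk (x.f0 * y.f0) (x.f0 * y.fV + x.fV * y.f0) (x.f0 * y.fW + x.fW * y.f0)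
    (x.f0 * y.f2 + (x.fV * y.fW - x.fW * y.fV) + x.f2 * y.f0)
    (by simp [sigma_f0])
    (by simp only [map_add, map_mul, sigma_f0, sigma_fV]; noncomm_ring)
    (by simp only [map_add, map_mul, sigma_f0, sigma_fW]; noncomm_ring)
    (by simp only [map_add, map_sub, map_mul, sigma_f0, sigma_fV, sigma_fW, sigma_f2]
        noncomm_ring)⟩

section mul
variable (x y : PillowForm θ)
@[simp] theorem f0_one : (1 : PillowForm θ).f0 = 1 := rfl
@[simp] theorem fV_one : (1 : PillowForm θ).fV = 0 := rfl
@[simp] theorem fW_one : (1 : PillowForm θ).fW = 0 := rfl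
@[simp] theorem f2_one : (1 : PillowForm θ).f2 = 0 := rfl
@[simp] theorem f0_mul : (x * y).f0 = x.f0 * y.f0 := rfl
@[simp] theorem fV_mul : (x * y).fV = x.f0 * y.fV + x.fV * y.f0 := rfl
@[simp] theorem fW_mul : (x * y).fW = x.f0 * y.fW + x.fW * y.f0 := rfl
@[simp] theorem f2_mul :
    (x * y).f2 = x.f0 * y.f2 + (x.fV * y.fW - x.fW * y.fV) + x.f2 * y.f0 := rfl
end mul

noncomputable instance : Ring (PillowForm θ) :=
  { (inferInstance : AddCommGroup (PillowForm θ)) with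
    mul := (· * ·)
    one := 1
    mul_assoc := fun x y z => by
      ext <;> simp only [f0_mul, fV_mul, fW_mul, f2_mul] <;> noncomm_ring
    one_mul := fun x => by ext <;> simp
    mul_one := fun x => by ext <;> simp
    zero_mul := fun x => by ext <;> simp
    mul_zero := fun x => by ext <;> simp
    left_distrib := fun x y z => by
      ext <;> simp only [f0_mul, fV_mul, fW_mul, f2_mul, f0_add, fV_add, fW_add, f2_add] <;>
        noncomm_ring
    right_distrib := fun x y z => by
      ext <;> simp only [f0_mul, fV_mul, fW_mul, f2_mul, f0_add, fV_add, fW_add, f2_add] <;>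
        noncomm_ring }

noncomputable instance : Algebra ℂ (PillowForm θ) :=
  Algebra.ofModule
    (fun c x y => by ext <;> simp [smul_add, smul_sub])
    (fun c x y => by ext <;> simp [smul_add, smul_sub])

variable (θ)

/-- `Ω⁰ = 𝒪(ℙ_θ)`, `Ω¹ = 𝒪(𝕋²_θ)₋ ⊕ 𝒪(𝕋²_θ)₋`, `Ω² = 𝒪(ℙ_θ)` and `Ωⁿ = 0` for `n > 2`, as
subspaces of the total space. -/
noncomputable def grade : ℕ → Submodule ℂ (PillowForm θ)
  | 0 =>
    { carrier := {x | x.fV = 0 ∧ x.fW = 0 ∧ x.f2 = 0}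
      add_mem' := by rintro x y ⟨h1, h2, h3⟩ ⟨h4, h5, h6⟩; simp [*]
      zero_mem' := by simp
      smul_mem' := by rintro c x ⟨h1, h2, h3⟩; simp [*] }
  | 1 =>
    { carrier := {x | x.f0 = 0 ∧ x.f2 = 0}
      add_mem' := by rintro x y ⟨h1, h2⟩ ⟨h3, h4⟩; simp [*]
      zero_mem' := by simp
      smul_mem' := by rintro c x ⟨h1, h2⟩; simp [*] }
  | 2 =>
    { carrier := {x | x.f0 = 0 ∧ x.fV = 0 ∧ x.fW = 0}
      add_mem' := by rintro x y ⟨h1, h2, h3⟩ ⟨h4, h5, h6⟩; simp [*]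
      zero_mem' := by simp
      smul_mem' := by rintro c x ⟨h1, h2, h3⟩; simp [*] }
  | _ + 3 => ⊥

variable {θ}

theorem mem_grade_zero {x : PillowForm θ} :
    x ∈ grade θ 0 ↔ x.fV = 0 ∧ x.fW = 0 ∧ x.f2 = 0 := Iff.rfl

theorem mem_grade_one {x : PillowForm θ} : x ∈ grade θ 1 ↔ x.f0 = 0 ∧ x.f2 = 0 := Iff.rfl

theorem mem_grade_two {x : PillowForm θ} :
    x ∈ grade θ 2 ↔ x.f0 = 0 ∧ x.fV = 0 ∧ x.fW = 0 := Iff.rfl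

theorem mem_grade_add_three {n : ℕ} {x : PillowForm θ} : x ∈ grade θ (n + 3) ↔ x = 0 := Iff.rfl

instance : SetLike.GradedMonoid (grade θ) where
  one_mem := by simp [mem_grade_zero]
  mul_mem := by
    intro i j x y hx hy
    match i, j with
    | 0, 0 => obtain ⟨_, _, _⟩ := hx; obtain ⟨_, _, _⟩ := hy; simp [mem_grade_zero, *]
    | 0, 1 => obtain ⟨_, _, _⟩ := hx; obtain ⟨_, _⟩ := hy; simp [mem_grade_one, *]
    | 0, 2 => obtain ⟨_, _, _⟩ := hx; obtain ⟨_, _, _⟩ := hy; simp [mem_grade_two, *]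
    | 1, 0 => obtain ⟨_, _⟩ := hx; obtain ⟨_, _, _⟩ := hy; simp [mem_grade_one, *]
    | 1, 1 => obtain ⟨_, _⟩ := hx; obtain ⟨_, _⟩ := hy; simp [mem_grade_two, *]
    | 2, 0 => obtain ⟨_, _, _⟩ := hx; obtain ⟨_, _, _⟩ := hy; simp [mem_grade_two, *]
    | 1, 2 =>
      obtain ⟨_, _⟩ := hx; obtain ⟨_, _, _⟩ := hy
      refine (mem_grade_add_three (n := 0)).2 ?_
      ext <;> simp [*]
    | 2, 1 =>
      obtain ⟨_, _, _⟩ := hx; obtain ⟨_, _⟩ := hy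
      refine (mem_grade_add_three (n := 0)).2 ?_
      ext <;> simp [*]
    | 2, 2 =>
      obtain ⟨_, _, _⟩ := hx; obtain ⟨_, _, _⟩ := hy
      refine (mem_grade_add_three (n := 1)).2 ?_
      ext <;> simp [*]
    | n + 3, j =>
      rw [mem_grade_add_three] at hx
      rw [hx, zero_mul]; exact Submodule.zero_mem _
    | i, n + 3 =>
      rw [mem_grade_add_three] at hy
      rw [hy, mul_zero]; exact Submodule.zero_mem _

/-- The decomposition of a form into its homogeneous components. -/
noncomputable def decompose :
    PillowForm θ →ₗ[ℂ] DirectSum ℕ fun i => grade θ i where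
  toFun x :=
    DirectSum.lof ℂ ℕ (fun i => grade θ i) 0
      ⟨mk x.f0 0 0 0 x.sigma_f0 (by simp) (by simp) (by simp), by simp [mem_grade_zero]⟩ +
    DirectSum.lof ℂ ℕ (fun i => grade θ i) 1
      ⟨mk 0 x.fV x.fW 0 (by simp) x.sigma_fV x.sigma_fW (by simp), by simp [mem_grade_one]⟩ +
    DirectSum.lof ℂ ℕ (fun i => grade θ i) 2
      ⟨mk 0 0 0 x.f2 (by simp) (by simp) (by simp) x.sigma_f2, by simp [mem_grade_two]⟩
  map_add' x y := by
    rw [show ∀ a b c a' b' c' : DirectSum ℕ fun i => grade θ i,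
      a + b + c + (a' + b' + c') = (a + a') + (b + b') + (c + c') by intros; abel]
    simp only [← map_add]
    congr 1
    · congr 1
      · congr 1; apply Subtype.ext; apply PillowForm.ext <;> simp
      · congr 1; apply Subtype.ext; apply PillowForm.ext <;> simp
    · congr 1; apply Subtype.ext; apply PillowForm.ext <;> simp
  map_smul' c x := by
    simp only [RingHom.id_apply, smul_add, ← map_smul]
    congr 1
    · congr 1
      · congr 1; apply Subtype.ext; apply PillowForm.ext <;> simp
      · congr 1; apply Subtype.ext; apply PillowForm.ext <;> simp
    · congr 1; apply Subtype.ext; apply PillowForm.ext <;> simp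

theorem isInternal : DirectSum.IsInternal (grade θ) := by
  let _ : DirectSum.Decomposition (grade θ) :=
    DirectSum.Decomposition.ofLinearMap (grade θ) decompose
      (by
        refine LinearMap.ext fun x => ?_
        simp only [LinearMap.comp_apply, decompose, LinearMap.coe_mk, AddHom.coe_mk, map_add,
          DirectSum.coeLinearMap_lof]
        ext <;> simp)
      (by
        refine DirectSum.linearMap_ext _ fun i => LinearMap.ext fun x => ?_
        simp only [LinearMap.comp_apply, DirectSum.coeLinearMap_lof, LinearMap.id_apply]
        obtain ⟨x, hx⟩ := x
        have key : ∀ (i : ℕ) (y z : grade θ i), y.1 = z.1 →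
            DirectSum.lof ℂ ℕ (fun i => grade θ i) i y
              = DirectSum.lof ℂ ℕ (fun i => grade θ i) i z :=
          fun i y z h => congrArg _ (Subtype.ext h)
        match i with
        | 0 =>
          obtain ⟨h1, h2, h3⟩ := id hx
          refine (congrArg₂ (· + ·) (congrArg₂ (· + ·) (key 0 _ ⟨x, hx⟩ ?_) (key 1 _ 0 ?_))
            (key 2 _ 0 ?_)).trans (by simp; rfl) <;> ext <;> simp [*]
        | 1 =>
          obtain ⟨h1, h2⟩ := id hx
          refine (congrArg₂ (· + ·) (congrArg₂ (· + ·) (key 0 _ 0 ?_) (key 1 _ ⟨x, hx⟩ ?_))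
            (key 2 _ 0 ?_)).trans (by simp; rfl) <;> ext <;> simp [*]
        | 2 =>
          obtain ⟨h1, h2, h3⟩ := id hx
          refine (congrArg₂ (· + ·) (congrArg₂ (· + ·) (key 0 _ 0 ?_) (key 1 _ 0 ?_))
            (key 2 _ ⟨x, hx⟩ ?_)).trans (by simp; rfl) <;> ext <;> simp [*]
        | n + 3 =>
          have h0 := mem_grade_add_three.1 hx
          rw [key (n + 3) ⟨x, hx⟩ 0 h0, map_zero]
          exact (congrArg _ h0).trans (map_zero _))
  exact DirectSum.Decomposition.isInternal _

/-- The differential: `a ↦ (∂_V a, ∂_W a)` on `Ω⁰` and `(a₁, a₂) ↦ ∂_V a₂ - ∂_W a₁` on `Ω¹`. -/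
noncomputable def d : PillowForm θ →ₗ[ℂ] PillowForm θ where
  toFun x := mk 0 (Torus.derV x.f0) (Torus.derW x.f0) (Torus.derV x.fW - Torus.derW x.fV)
    (by simp)
    (by rw [← neg_eq_iff_eq_neg, Torus.derV, ← Torus.der_sigma, sigma_f0])
    (by rw [← neg_eq_iff_eq_neg, Torus.derW, ← Torus.der_sigma, sigma_f0])
    (by
      have h1 := Torus.der_sigma Complex.I 0 x.fW
      have h2 := Torus.der_sigma 0 Complex.I x.fV
      rw [sigma_fW, map_neg, neg_inj] at h1
      rw [sigma_fV, map_neg, neg_inj] at h2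
      rw [map_sub, Torus.derV, Torus.derW, ← h1, ← h2])
  map_add' x y := by ext <;> simp; abel
  map_smul' c x := by ext <;> simp [smul_sub]

section d
variable (x : PillowForm θ)
@[simp] theorem f0_d : (d x).f0 = 0 := rfl
@[simp] theorem fV_d : (d x).fV = Torus.derV x.f0 := rfl
@[simp] theorem fW_d : (d x).fW = Torus.derW x.f0 := rfl
@[simp] theorem f2_d : (d x).f2 = Torus.derV x.fW - Torus.derW x.fV := rfl
end d

/-- The inclusion of `𝒪(ℙ_θ)` as `Ω⁰`. -/
noncomputable def incl : Pillow θ →ₐ[ℂ] PillowForm θ :=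
  AlgHom.ofLinearMap
    { toFun := fun a => mk a 0 0 0 (mem_pillow.1 a.2) (by simp) (by simp) (by simp)
      map_add' := fun a b => by ext <;> simp
      map_smul' := fun c a => by ext <;> simp }
    (by ext <;> simp)
    (fun a b => by ext <;> simp)

end PillowForm

/-- The differential graded algebra `Ω(ℙ_θ)` over `𝒪(ℙ_θ)`. -/
noncomputable def pillowCalculus (θ : ℝ) : DGAlgebraOver ℂ (Pillow θ) where
  Form := PillowForm θ
  grade := PillowForm.grade θ
  isInternal := PillowForm.isInternal
  d := PillowForm.d
  d_mem := by
    intro n x hx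
    match n with
    | 0 => obtain ⟨_, _, _⟩ := hx; simp [PillowForm.mem_grade_one, *]
    | 1 => obtain ⟨_, _⟩ := hx; simp [PillowForm.mem_grade_two, *]
    | 2 =>
      obtain ⟨_, _, _⟩ := hx
      refine (PillowForm.mem_grade_add_three (n := 0)).2 ?_
      ext <;> simp [*]
    | n + 3 =>
      rw [PillowForm.mem_grade_add_three] at hx
      rw [hx, map_zero]; exact Submodule.zero_mem _
  leibniz := by
    intro n x y hx
    match n with
    | 0 =>
      obtain ⟨h1, h2, h3⟩ := hx
      ext <;> simp [h1, h2, h3, Torus.derV, Torus.derW, Torus.der_mul]; noncomm_ring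
    | 1 =>
      obtain ⟨h1, h2⟩ := hx
      ext <;> simp [h1, h2, Torus.derV, Torus.derW, Torus.der_mul] ; noncomm_ring
    | 2 =>
      obtain ⟨h1, h2, h3⟩ := hx
      ext <;> simp [h1, h2, h3]
    | n + 3 =>
      rw [PillowForm.mem_grade_add_three] at hx
      simp [hx]
  d_d := by
    intro x
    ext <;> simp [Torus.derV, Torus.derW]
    rw [Torus.der_comm, sub_self]
  ι := PillowForm.incl
  ι_injective := fun a b h => Subtype.ext (congrArg PillowForm.f0 h)
  range_ι := by
    ext x
    constructor
    · rintro ⟨a, rfl⟩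
      exact ⟨rfl, rfl, rfl⟩
    · rintro ⟨h1, h2, h3⟩
      exact ⟨⟨x.f0, x.sigma_f0⟩, PillowForm.ext rfl h1.symm h2.symm h3.symm⟩

/-! The monomials `VᵐWⁿ` form a basis of the torus algebra, so the `σ`-even and `σ`-odd parts are
spanned by the symmetric and antisymmetric combinations `even m n` and `odd m n`. A product of two
of these is a combination of exactly two others, and the coefficients change when the factors are
swapped. Irrationality enters only through `λ^(-q) ≠ λ^q` for `q ≠ 0`: then the two orders of
multiplication give an invertible 2×2 system, and each term can be isolated.

Three consequences follow. A subspace stable under the pillow on both sides and containing `odd 1 0`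
(or `odd 0 1`) contains all odd elements, so exact forms generate `Ω¹`. The even part equals `Minus
θ * Minus θ`, which gives `Ω²`. The elements `even 1 0` and `even 0 1` generate the pillow.
Connectedness is read off from coefficients.

For integrability, the projection `vol` onto `Ω²` is a bimodule map. If all pairings `vol (ω ∧ η)`
in complementary degrees are perfect, they serve as the `Θ`s, with divergence `vol ∘ d` and trivial
twist; flatness is `d² = 0`. Perfectness in degree one comes from writing `1` as a sum of products
of odd elements (`exists_eq_mul_of_right_linear`).

For the dimension, words of length `n` have exponents in a box of side `O(n)`, while words of length
`O(n)` already produce `n²` independent elements `even p q`. -/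

/-! ### The parameter `λ` and commutation of powers. -/

theorem torusParam_ne_zero (θ : ℝ) : torusParam θ ≠ 0 := Complex.exp_ne_zero _

theorem torusParam_zpow_ne_one {θ : ℝ} (hθ : Irrational θ) {n : ℤ} (hn : n ≠ 0) :
    torusParam θ ^ n ≠ 1 := by
  rw [torusParam, ← Complex.exp_int_mul]
  intro h
  obtain ⟨m, hm⟩ := Complex.exp_eq_one_iff.1 h
  have h2 : (2 * Real.pi * Complex.I : ℂ) ≠ 0 := Complex.two_pi_I_ne_zero
  have h3 : (n * θ : ℂ) = m := by
    apply mul_right_cancel₀ h2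
    rw [← hm]; ring
  have h4 : (n * θ : ℝ) = m := by exact_mod_cast h3
  exact (hθ.intCast_mul hn).ne_int m h4

/-- If `W` and `V` commute up to a central factor `c⁻¹`, so do their powers. -/
theorem zpow_mul_zpow_of_mul_eq {G : Type*} [Group G] {c v w : G} (hc : ∀ g, Commute c g)
    (h : v * w = c * (w * v)) (n p : ℤ) : w ^ n * v ^ p = c ^ (-(n * p)) * (v ^ p * w ^ n) := by
  have h1 : v * w * v⁻¹ = c * w := by rw [h]; group
  have h2 : v * w ^ n * v⁻¹ = c ^ n * w ^ n := by
    rw [← conj_zpow, h1, (hc w).mul_zpow]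
  have h3 : w ^ n * v * (w ^ n)⁻¹ = c ^ (-n) * v := by
    have h4 : v * w ^ n = c ^ n * w ^ n * v := by rw [← h2]; group
    rw [mul_inv_eq_iff_eq_mul, mul_assoc, h4]; group
  have h5 : w ^ n * v ^ p * (w ^ n)⁻¹ = c ^ (-(n * p)) * v ^ p := by
    rw [← conj_zpow, h3, ((hc v).zpow_left (-n)).mul_zpow, ← zpow_mul, neg_mul]
  rw [← mul_assoc, ← h5]; group

/-! ### The monomial basis of the torus algebra. -/

namespace Torus

variable {θ : ℝ}

/-- The monomial `VᵐWⁿ`. -/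
noncomputable def mon (m n : ℤ) : Torus θ := ((unitV ^ m * unitW ^ n : (Torus θ)ˣ) : Torus θ)

theorem mon_zero_zero : (mon 0 0 : Torus θ) = 1 := by simp [mon]

/-- `λ` as a central unit of the torus algebra. -/
noncomputable def unitParam : (Torus θ)ˣ :=
  Units.map (algebraMap ℂ (Torus θ) : ℂ →* Torus θ) (Units.mk0 _ (torusParam_ne_zero θ))

theorem unitParam_zpow_mul (n : ℤ) (a : Torus θ) :
    ((unitParam ^ n : (Torus θ)ˣ) : Torus θ) * a = torusParam θ ^ n • a := by
  rw [unitParam, ← map_zpow, Units.coe_map, Algebra.smul_def]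
  simp

theorem unitW_zpow_mul_unitV_zpow (n p : ℤ) :
    (unitW ^ n * unitV ^ p : (Torus θ)ˣ) = unitParam ^ (-(n * p)) * (unitV ^ p * unitW ^ n) := by
  apply zpow_mul_zpow_of_mul_eq
  · intro g
    apply Units.ext
    exact Algebra.commutes _ _
  · apply Units.ext
    have h := unitParam_zpow_mul 1 ((unitW * unitV : (Torus θ)ˣ) : Torus θ)
    rw [zpow_one, zpow_one] at h
    rw [Units.val_mul unitParam, h]
    exact V_W

/-- Only `Wⁿ` and `Vᵖ` have to be exchanged, and since `WV = λ⁻¹VW` each of the `n * p` exchanges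
costs `λ⁻¹`. -/
theorem mon_mul_mon (m n p q : ℤ) :
    (mon m n * mon p q : Torus θ) = torusParam θ ^ (-(n * p)) • mon (m + p) (n + q) := by
  rw [mon, mon, mon, ← Units.val_mul, ← unitParam_zpow_mul, ← Units.val_mul]
  congr 1
  have hc : Commute (unitParam ^ (-(n * p)) : (Torus θ)ˣ) (unitV ^ m) := by
    apply Units.ext
    rw [Units.val_mul, Units.val_mul, unitParam_zpow_mul, unitParam, ← map_zpow, Units.coe_map]
    exact ((Algebra.commutes _ _).symm.trans (by rw [Algebra.smul_def]; simp)).symm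
  calc (unitV ^ m * unitW ^ n * (unitV ^ p * unitW ^ q) : (Torus θ)ˣ)
      = unitV ^ m * (unitW ^ n * unitV ^ p) * unitW ^ q := by group
    _ = unitV ^ m * unitParam ^ (-(n * p)) * (unitV ^ p * unitW ^ n * unitW ^ q) := by
        rw [unitW_zpow_mul_unitV_zpow]; group
    _ = _ := by rw [← hc.eq, zpow_add, zpow_add]; group

theorem sigma_mon (m n : ℤ) : sigma (mon m n : Torus θ) = mon (-m) (-n) := by
  have hV : Units.map ((sigma : Torus θ →ₐ[ℂ] Torus θ) : Torus θ →* Torus θ) unitV = unitV⁻¹ :=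
    Units.ext (by simp [sigma, unitV])
  have hW : Units.map ((sigma : Torus θ →ₐ[ℂ] Torus θ) : Torus θ →* Torus θ) unitW = unitW⁻¹ :=
    Units.ext (by simp [sigma, unitW])
  have h : Units.map ((sigma : Torus θ →ₐ[ℂ] Torus θ) : Torus θ →* Torus θ) (unitV ^ m * unitW ^ n)
      = unitV ^ (-m) * unitW ^ (-n) := by
    rw [map_mul, map_zpow, map_zpow, hV, hW, inv_zpow', inv_zpow']
  exact congrArg Units.val h

theorem gen_V_mul_mon (m n : ℤ) : (gen .V * mon m n : Torus θ) = mon (m + 1) n := by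
  have h := mon_mul_mon (θ := θ) 1 0 m n
  simpa [mon, unitV, add_comm] using h

theorem gen_Vs_mul_mon (m n : ℤ) : (gen .Vs * mon m n : Torus θ) = mon (m - 1) n := by
  rw [show m = (m - 1) + 1 by ring, ← gen_V_mul_mon, ← mul_assoc, Vs_V, one_mul]; simp

theorem gen_W_mul_mon (n : ℤ) : (gen .W * mon 0 n : Torus θ) = mon 0 (n + 1) := by
  have h := mon_mul_mon (θ := θ) 0 1 0 n
  simpa [mon, unitW, add_comm] using h

theorem gen_Ws_mul_mon (n : ℤ) : (gen .Ws * mon 0 n : Torus θ) = mon 0 (n - 1) := by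
  rw [show n = (n - 1) + 1 by ring, ← gen_W_mul_mon, ← mul_assoc, Ws_W, one_mul]; simp

theorem gen_mem_range_mon (g : TorusGen) : ∃ m n, (gen g : Torus θ) = mon m n := by
  cases g
  · exact ⟨_, _, by rw [← gen_V_mul_mon 0 0, mon_zero_zero, mul_one]⟩
  · exact ⟨_, _, by rw [← gen_Vs_mul_mon 0 0, mon_zero_zero, mul_one]⟩
  · exact ⟨_, _, by rw [← gen_W_mul_mon 0, mon_zero_zero, mul_one]⟩
  · exact ⟨_, _, by rw [← gen_Ws_mul_mon 0, mon_zero_zero, mul_one]⟩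

theorem span_mon :
    Submodule.span ℂ (Set.range fun x : ℤ × ℤ => (mon x.1 x.2 : Torus θ)) = ⊤ := by
  refine eq_top_iff.2 fun a _ => ?_
  induction a using Torus.induction with
  | halg c =>
    rw [Algebra.algebraMap_eq_smul_one, ← mon_zero_zero]
    exact Submodule.smul_mem _ _ (Submodule.subset_span ⟨(0, 0), rfl⟩)
  | hgen g =>
    obtain ⟨m, n, h⟩ := gen_mem_range_mon (θ := θ) g
    exact h ▸ Submodule.subset_span ⟨(m, n), rfl⟩
  | hmul a b ha hb =>
    have h := Submodule.mul_mem_mul (ha trivial) (hb trivial)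
    rw [Submodule.span_mul_span] at h
    refine Submodule.span_le.2 ?_ h
    rintro _ ⟨_, ⟨x, rfl⟩, _, ⟨y, rfl⟩, rfl⟩
    simp only [mon_mul_mon]
    exact Submodule.smul_mem _ _ (Submodule.subset_span ⟨(x.1 + y.1, x.2 + y.2), rfl⟩)
  | hadd a b ha hb => exact Submodule.add_mem _ (ha trivial) (hb trivial)

/-- The operator `e_x ↦ t(x) e_{x + s}`. -/
noncomputable def shiftOp (s : ℤ × ℤ) (t : ℤ × ℤ → ℂ) : Module.End ℂ (ℤ × ℤ →₀ ℂ) :=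
  Finsupp.linearCombination ℂ fun x => Finsupp.single (x + s) (t x)

theorem shiftOp_single (s : ℤ × ℤ) (t : ℤ × ℤ → ℂ) (x : ℤ × ℤ) (c : ℂ) :
    shiftOp s t (Finsupp.single x c) = Finsupp.single (x + s) (c * t x) := by
  simp [shiftOp]

/-- The regular representation in the basis of monomials. -/
noncomputable def rep : Torus θ →ₐ[ℂ] Module.End ℂ (ℤ × ℤ →₀ ℂ) :=
  lift (fun
    | .V => shiftOp (1, 0) fun _ => 1
    | .Vs => shiftOp (-1, 0) fun _ => 1
    -- The factor comes from `W · VᵐWⁿ = λ^(-m) VᵐWⁿ⁺¹`.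
    | .W => shiftOp (0, 1) fun x => torusParam θ ^ (-x.1)
    | .Ws => shiftOp (0, -1) fun x => torusParam θ ^ x.1)
    (by refine Finsupp.lhom_ext fun x c => ?_; simp [shiftOp_single, add_assoc, ← Prod.zero_eq_mk])
    (by refine Finsupp.lhom_ext fun x c => ?_; simp [shiftOp_single, add_assoc, ← Prod.zero_eq_mk])
    (by
      refine Finsupp.lhom_ext fun x c => ?_
      have h := zpow_ne_zero x.1 (torusParam_ne_zero θ)
      simp only [Module.End.mul_apply, shiftOp_single]
      simp [add_assoc, h, ← Prod.zero_eq_mk])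
    (by
      refine Finsupp.lhom_ext fun x c => ?_
      have h := zpow_ne_zero x.1 (torusParam_ne_zero θ)
      simp only [Module.End.mul_apply, shiftOp_single]
      simp [add_assoc, h, ← Prod.zero_eq_mk])
    (by
      refine Finsupp.lhom_ext fun x c => ?_
      have h := torusParam_ne_zero θ
      simp only [Module.End.mul_apply, LinearMap.smul_apply, shiftOp_single, Finsupp.smul_single,
        add_assoc, Prod.mk_add_mk, Prod.fst_add, smul_eq_mul]
      rw [neg_add, zpow_add₀ h, zpow_neg_one]
      congr 1
      field_simp)

/-- The coefficients with respect to the monomials. -/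
noncomputable def coeff : Torus θ →ₗ[ℂ] (ℤ × ℤ →₀ ℂ) :=
  (LinearMap.applyₗ (Finsupp.single 0 1)).comp rep.toLinearMap

theorem coeff_mul (a b : Torus θ) : coeff (a * b) = rep a (coeff b) := by
  simp [coeff]

/-- This is the linear independence of the monomials. The powers of `W` are built first, on `V⁰`,
where the scalar in `rep` is `1`; the powers of `V` on the left then shift without scalars. -/
theorem coeff_mon (m n : ℤ) : coeff (mon m n : Torus θ) = Finsupp.single (m, n) 1 := by
  induction m with
  | zero =>
    induction n with
    | zero => rw [mon_zero_zero]; simp [coeff, ← Prod.zero_eq_mk]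
    | succ n ih => rw [← gen_W_mul_mon, coeff_mul, ih]; simp [rep, shiftOp_single]
    | pred n ih =>
      rw [← gen_Ws_mul_mon, coeff_mul, ih]; simp [rep, shiftOp_single, sub_eq_add_neg]
  | succ m ih => rw [← gen_V_mul_mon, coeff_mul, ih]; simp [rep, shiftOp_single]
  | pred m ih =>
    rw [← gen_Vs_mul_mon, coeff_mul, ih]; simp [rep, shiftOp_single, sub_eq_add_neg]

instance : Nontrivial (Torus θ) := by
  refine ⟨⟨1, 0, fun h => ?_⟩⟩
  have h1 := congrArg coeff h
  rw [← mon_zero_zero, coeff_mon, map_zero] at h1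
  exact one_ne_zero (Finsupp.single_eq_zero.1 h1)

/-! ### Even and odd combinations of monomials. -/

/-- `VᵐWⁿ + V⁻ᵐW⁻ⁿ`. -/
noncomputable def even (m n : ℤ) : Torus θ := mon m n + mon (-m) (-n)

/-- `VᵐWⁿ - V⁻ᵐW⁻ⁿ`. -/
noncomputable def odd (m n : ℤ) : Torus θ := mon m n - mon (-m) (-n)

theorem even_neg (m n : ℤ) : (even (-m) (-n) : Torus θ) = even m n := by
  simp [even, add_comm]

theorem odd_neg (m n : ℤ) : (odd (-m) (-n) : Torus θ) = -odd m n := by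
  simp [odd]

theorem even_mem (m n : ℤ) : (even m n : Torus θ) ∈ Pillow θ := by
  rw [mem_pillow]; simp [even, sigma_mon, add_comm]

theorem odd_mem (m n : ℤ) : (odd m n : Torus θ) ∈ Minus θ := by
  rw [mem_minus]; simp [odd, sigma_mon]

/-- Negating both exponent pairs preserves the factor `λ^(-np)` and negating one of them inverts it,
so the four products of monomials group into two combinations. The three companion formulas differ
only in signs. -/
theorem even_mul_even (m n p q : ℤ) : (even m n * even p q : Torus θ) =
    torusParam θ ^ (-(n * p)) • even (m + p) (n + q) +
      torusParam θ ^ (n * p) • even (m - p) (n - q) := by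
  simp only [even, add_mul, mul_add, mon_mul_mon, neg_mul, mul_neg, neg_neg,
    smul_add]
  rw [show -(m + p) = -m + -p by ring, show -(n + q) = -n + -q by ring,
    show -(m - p) = -m + p by ring, show -(n - q) = -n + q by ring, sub_eq_add_neg m p,
    sub_eq_add_neg n q]
  abel

theorem even_mul_odd (m n p q : ℤ) : (even m n * odd p q : Torus θ) =
    torusParam θ ^ (-(n * p)) • odd (m + p) (n + q) -
      torusParam θ ^ (n * p) • odd (m - p) (n - q) := by
  simp only [even, odd, add_mul, mul_sub, mon_mul_mon, neg_mul, mul_neg, neg_neg,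
    smul_sub]
  rw [show -(m + p) = -m + -p by ring, show -(n + q) = -n + -q by ring,
    show -(m - p) = -m + p by ring, show -(n - q) = -n + q by ring, sub_eq_add_neg m p,
    sub_eq_add_neg n q]
  abel

theorem odd_mul_even (m n p q : ℤ) : (odd m n * even p q : Torus θ) =
    torusParam θ ^ (-(n * p)) • odd (m + p) (n + q) +
      torusParam θ ^ (n * p) • odd (m - p) (n - q) := by
  simp only [even, odd, sub_mul, mul_add, mon_mul_mon, neg_mul, mul_neg, neg_neg,
    smul_sub]
  rw [show -(m + p) = -m + -p by ring, show -(n + q) = -n + -q by ring,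
    show -(m - p) = -m + p by ring, show -(n - q) = -n + q by ring, sub_eq_add_neg m p,
    sub_eq_add_neg n q]
  abel

theorem odd_mul_odd (m n p q : ℤ) : (odd m n * odd p q : Torus θ) =
    torusParam θ ^ (-(n * p)) • even (m + p) (n + q) -
      torusParam θ ^ (n * p) • even (m - p) (n - q) := by
  simp only [even, odd, sub_mul, mul_sub, mon_mul_mon, neg_mul, mul_neg, neg_neg,
    smul_add]
  rw [show -(m + p) = -m + -p by ring, show -(n + q) = -n + -q by ring,
    show -(m - p) = -m + p by ring, show -(n - q) = -n + q by ring, sub_eq_add_neg m p,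
    sub_eq_add_neg n q]
  abel

/-- The map `id + σ` sends monomials to the elements `even m n` and doubles every invariant element.
The odd case uses `id - σ`. -/
theorem pillow_le_of_even_mem {S : Submodule ℂ (Torus θ)} (hS : ∀ m n, even m n ∈ S) :
    (Pillow θ).toSubmodule ≤ S := by
  intro a ha
  have h : a ∈ S.comap (LinearMap.id + sigma.toLinearMap) := by
    have : ⊤ ≤ S.comap (LinearMap.id + sigma.toLinearMap) := by
      rw [← span_mon, Submodule.span_le]
      rintro _ ⟨x, rfl⟩
      simpa [sigma_mon, even, odd] using hS x.1 x.2
    exact this trivial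
  have h2 : a + a ∈ S := by
    have h3 : sigma a = a := ha
    simpa [h3] using h
  simpa [← two_smul ℂ a, smul_smul] using S.smul_mem (1 / 2 : ℂ) h2

theorem minus_le_of_odd_mem {S : Submodule ℂ (Torus θ)} (hS : ∀ m n, odd m n ∈ S) :
    Minus θ ≤ S := by
  intro a ha
  have h : a ∈ S.comap (LinearMap.id - sigma.toLinearMap) := by
    have : ⊤ ≤ S.comap (LinearMap.id - sigma.toLinearMap) := by
      rw [← span_mon, Submodule.span_le]
      rintro _ ⟨x, rfl⟩
      simpa [sigma_mon, even, odd] using hS x.1 x.2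
    exact this trivial
  have h2 : a + a ∈ S := by
    have h3 : sigma a = -a := ha
    simpa [h3] using h
  simpa [← two_smul ℂ a, smul_smul] using S.smul_mem (1 / 2 : ℂ) h2

end Torus

/-! ### Isolating terms by multiplying in both orders. -/

/-- Cramer's rule: `e` times the first combination minus `b` times the second is `(a * e - b * c) •
s`. -/
theorem Submodule.left_mem_of_det_ne_zero {k M : Type*} [Field k] [AddCommGroup M] [Module k M]
    (S : Submodule k M) {s t : M} {a b c e : k} (h1 : a • s + b • t ∈ S) (h2 : c • s + e • t ∈ S)
    (h : a * e - b * c ≠ 0) : s ∈ S := by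
  have h3 := S.smul_mem (a * e - b * c)⁻¹ (S.sub_mem (S.smul_mem e h1) (S.smul_mem b h2))
  convert h3 using 1
  rw [eq_inv_smul_iff₀ h]
  module

namespace Torus

variable {θ : ℝ}

theorem torusParam_zpow_neg_ne (hθ : Irrational θ) {q : ℤ} (hq : q ≠ 0) :
    torusParam θ ^ (-q) ≠ torusParam θ ^ q := by
  intro h
  refine torusParam_zpow_ne_one hθ (n := q + q) (by omega) ?_
  have h0 := torusParam_ne_zero θ
  rw [zpow_add₀ h0]
  nth_rewrite 1 [← h]
  rw [← zpow_add₀ h0]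
  simp

/-- A subspace which contains `V - V*` and is stable under `𝒪(ℙ_θ)` contains `𝒪(𝕋²_θ)₋`. -/
theorem minus_le_of_odd_one_zero_mem (hθ : Irrational θ) {S : Submodule ℂ (Torus θ)}
    (hl : ∀ a ∈ Pillow θ, ∀ y ∈ S, a * y ∈ S) (hr : ∀ a ∈ Pillow θ, ∀ y ∈ S, y * a ∈ S)
    (h : odd 1 0 ∈ S) : Minus θ ≤ S := by
  -- Multiplying `odd 1 0` by `even (p - 1) q` on either side combines the same elements `odd p q`
  -- and `odd (p - 2) q`; the determinant is `λ^(-q) - λ^q`.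
  have key : ∀ p q : ℤ, q ≠ 0 → odd p q ∈ S := by
    intro p q hq
    have h1 := hl _ (even_mem (p - 1) q) _ h
    have h2 := hr _ (even_mem (p - 1) q) _ h
    rw [even_mul_odd, sub_eq_add_neg, ← smul_neg] at h1
    rw [odd_mul_even, show 1 - (p - 1) = -(p - 1 - 1) by ring, show 0 - q = -(q - 0) by ring,
      odd_neg, show 1 + (p - 1) = p - 1 + 1 by ring, zero_add, zero_mul] at h2
    simp only [sub_add_cancel, add_zero] at h1 h2
    refine S.left_mem_of_det_ne_zero h1 h2 ?_
    simpa [sub_eq_zero] using torusParam_zpow_neg_ne hθ hq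
  refine minus_le_of_odd_mem fun p q => ?_
  by_cases hq : q = 0
  · subst hq
    -- The row `q = 0` is reached from row `1`: this product combines `odd p 2`, already in `S`,
    -- with `odd (-p) 0`.
    have h1 := hl _ (even_mem 0 1) _ (key p 1 one_ne_zero)
    rw [even_mul_odd, Submodule.sub_mem_iff_right _ (S.smul_mem _ (key _ _ (by norm_num)))] at h1
    have h2 := (S.smul_mem_iff (zpow_ne_zero _ (torusParam_ne_zero θ))).1 h1
    rw [show (0 : ℤ) - p = -p by ring, show (1 : ℤ) - 1 = -0 by ring, odd_neg] at h2
    exact S.neg_mem_iff.1 h2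
  · exact key p q hq

/-- A subspace which contains `W - W*` and is stable under `𝒪(ℙ_θ)` contains `𝒪(𝕋²_θ)₋`. -/
theorem minus_le_of_odd_zero_one_mem (hθ : Irrational θ) {S : Submodule ℂ (Torus θ)}
    (hl : ∀ a ∈ Pillow θ, ∀ y ∈ S, a * y ∈ S) (hr : ∀ a ∈ Pillow θ, ∀ y ∈ S, y * a ∈ S)
    (h : odd 0 1 ∈ S) : Minus θ ≤ S := by
  have key : ∀ p q : ℤ, p ≠ 0 → odd p q ∈ S := by
    intro p q hp
    have h1 := hl _ (even_mem p (q - 1)) _ h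
    have h2 := hr _ (even_mem p (q - 1)) _ h
    rw [even_mul_odd, sub_eq_add_neg, ← smul_neg] at h1
    rw [odd_mul_even, show 1 - (q - 1) = -(q - 1 - 1) by ring, show 0 - p = -(p - 0) by ring,
      odd_neg, show 1 + (q - 1) = q - 1 + 1 by ring, zero_add, one_mul] at h2
    simp only [sub_add_cancel, add_zero] at h1 h2
    refine S.left_mem_of_det_ne_zero h1 h2 ?_
    simpa [sub_eq_zero] using (torusParam_zpow_neg_ne hθ hp).symm
  refine minus_le_of_odd_mem fun p q => ?_
  by_cases hp : p = 0
  · subst hp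
    have h1 := hl _ (even_mem 1 0) _ (key 1 q one_ne_zero)
    rw [even_mul_odd, Submodule.sub_mem_iff_right _ (S.smul_mem _ (key _ _ (by norm_num)))] at h1
    have h2 := (S.smul_mem_iff (zpow_ne_zero _ (torusParam_ne_zero θ))).1 h1
    rw [show (0 : ℤ) - q = -q by ring, show (1 : ℤ) - 1 = -0 by ring, odd_neg] at h2
    exact S.neg_mem_iff.1 h2
  · exact key p q hp

theorem mul_mem_minus_left {a y : Torus θ} (ha : a ∈ Pillow θ) (hy : y ∈ Minus θ) :
    a * y ∈ Minus θ := by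
  rw [mem_minus] at *
  rw [mem_pillow] at ha
  simp [ha, hy]

theorem mul_mem_minus_right {a y : Torus θ} (ha : a ∈ Pillow θ) (hy : y ∈ Minus θ) :
    y * a ∈ Minus θ := by
  rw [mem_minus] at *
  rw [mem_pillow] at ha
  simp [ha, hy]

theorem mul_mem_pillow {y z : Torus θ} (hy : y ∈ Minus θ) (hz : z ∈ Minus θ) :
    y * z ∈ Pillow θ := by
  rw [mem_minus] at *
  rw [mem_pillow]
  simp [hy, hz]

/-- Every element of `𝒪(ℙ_θ)` is a sum of products of two elements of `𝒪(𝕋²_θ)₋`. -/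
theorem pillow_le_minus_mul_minus (hθ : Irrational θ) :
    (Pillow θ).toSubmodule ≤ Minus θ * Minus θ := by
  have hS : ∀ m n p q : ℤ, (odd m n * odd p q : Torus θ) ∈ Minus θ * Minus θ :=
    fun m n p q => Submodule.mul_mem_mul (odd_mem m n) (odd_mem p q)
  have key1 : ∀ p q : ℤ, q ≠ 0 → (even p q : Torus θ) ∈ Minus θ * Minus θ := by
    intro p q hq
    have h1 := hS (p - 1) q 1 0
    have h2 := hS 1 0 (p - 1) q
    rw [odd_mul_odd, sub_eq_add_neg, ← neg_smul] at h1 h2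
    rw [show 1 - (p - 1) = -(p - 1 - 1) by ring, show 0 - q = -(q - 0) by ring,
      even_neg, show 1 + (p - 1) = p - 1 + 1 by ring, zero_add, zero_mul] at h2
    simp only [sub_add_cancel, add_zero] at h1 h2
    refine Submodule.left_mem_of_det_ne_zero _ h1 h2 ?_
    have := torusParam_zpow_neg_ne hθ hq
    contrapose this
    simp only [mul_one, neg_zero, zpow_zero] at this
    linear_combination -this
  have key2 : ∀ p q : ℤ, p ≠ 0 → (even p q : Torus θ) ∈ Minus θ * Minus θ := by
    intro p q hp
    have h1 := hS p (q - 1) 0 1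
    have h2 := hS 0 1 p (q - 1)
    rw [odd_mul_odd, sub_eq_add_neg, ← neg_smul] at h1 h2
    rw [show 1 - (q - 1) = -(q - 1 - 1) by ring, show 0 - p = -(p - 0) by ring,
      even_neg, show 1 + (q - 1) = q - 1 + 1 by ring, zero_add, one_mul] at h2
    simp only [sub_add_cancel, add_zero] at h1 h2
    refine Submodule.left_mem_of_det_ne_zero _ h1 h2 ?_
    have := torusParam_zpow_neg_ne hθ hp
    contrapose this
    simp only [mul_zero, neg_zero, zpow_zero] at this
    linear_combination this
  refine pillow_le_of_even_mem fun p q => ?_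
  by_cases hq : q = 0
  · by_cases hp : p = 0
    · subst hp hq
      -- The origin, where neither system is invertible: `odd 1 0` squared is `even 2 0 - even 0 0`,
      -- and `even 2 0` is already available.
      have h1 := hS 1 0 1 0
      rw [odd_mul_odd,
        Submodule.sub_mem_iff_right _ (Submodule.smul_mem _ _ (key2 _ _ (by norm_num)))] at h1
      simpa using h1
    · exact key2 p q hp
  · exact key1 p q hq

/-- The resulting expression `1 = ∑ sᵢtᵢ` with odd `sᵢ`, `tᵢ` acts as a dual basis in the degree-one
duality. -/
theorem one_mem_minus_mul_minus (hθ : Irrational θ) : (1 : Torus θ) ∈ Minus θ * Minus θ :=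
  pillow_le_minus_mul_minus hθ (one_mem (Pillow θ))

/-! ### The derivations on monomials and their common kernel. -/

theorem derV_even (m n : ℤ) : derV (even m n : Torus θ) = (Complex.I * m) • odd m n := by
  rw [even, map_add, mon, mon, derV_monomial, derV_monomial, odd, mon, mon]
  push_cast
  module

theorem derW_even (m n : ℤ) : derW (even m n : Torus θ) = (Complex.I * n) • odd m n := by
  rw [even, map_add, mon, mon, derW_monomial, derW_monomial, odd, mon, mon]
  push_cast
  module

theorem coeff_derV (a : Torus θ) (x : ℤ × ℤ) : coeff (derV a) x = Complex.I * x.1 * coeff a x := by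
  have h : a ∈ Submodule.span ℂ (Set.range fun x : ℤ × ℤ => (mon x.1 x.2 : Torus θ)) := by
    rw [span_mon]; trivial
  induction h using Submodule.span_induction with
  | mem a h =>
    obtain ⟨y, rfl⟩ := h
    simp only [mon, derV_monomial, map_smul]
    rw [← mon, coeff_mon]
    rcases eq_or_ne y x with rfl | hxy <;> simp [*]
  | zero => simp
  | add a b _ _ ha hb => simp [ha, hb, mul_add]
  | smul c a _ ha => simp [ha]; ring

theorem coeff_derW (a : Torus θ) (x : ℤ × ℤ) : coeff (derW a) x = Complex.I * x.2 * coeff a x := by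
  have h : a ∈ Submodule.span ℂ (Set.range fun x : ℤ × ℤ => (mon x.1 x.2 : Torus θ)) := by
    rw [span_mon]; trivial
  induction h using Submodule.span_induction with
  | mem a h =>
    obtain ⟨y, rfl⟩ := h
    simp only [mon, derW_monomial, map_smul]
    rw [← mon, coeff_mon]
    rcases eq_or_ne y x with rfl | hxy <;> simp [*]
  | zero => simp
  | add a b _ _ ha hb => simp [ha, hb, mul_add]
  | smul c a _ ha => simp [ha]; ring

/-- Summing monomials with the given coefficients is a left inverse of `coeff`, as is checked on the
spanning monomials. -/
theorem coeff_injective : Function.Injective (coeff : Torus θ → ℤ × ℤ →₀ ℂ) := by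
  have h : (Finsupp.linearCombination ℂ fun x : ℤ × ℤ => (mon x.1 x.2 : Torus θ)).comp coeff
      = LinearMap.id := by
    refine LinearMap.ext_on_range span_mon fun x => ?_
    simp [coeff_mon]
  exact Function.LeftInverse.injective (g := Finsupp.linearCombination ℂ _) (LinearMap.congr_fun h)

/-- The coefficient at `(p, q)` is killed by both `p` and `q`, so only the one at the origin can
survive. -/
theorem exists_algebraMap_eq {a : Torus θ} (hV : derV a = 0) (hW : derW a = 0) :
    ∃ c : ℂ, a = algebraMap ℂ (Torus θ) c := by
  refine ⟨coeff a 0, coeff_injective (Finsupp.ext fun x => ?_)⟩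
  rw [Algebra.algebraMap_eq_smul_one, ← mon_zero_zero, map_smul, coeff_mon]
  have h1 := coeff_derV a x
  have h2 := coeff_derW a x
  rw [hV] at h1
  rw [hW] at h2
  obtain ⟨p, q⟩ := x
  by_cases hx : p = 0 ∧ q = 0
  · simp [hx.1, hx.2, Prod.zero_eq_mk]
  · have h0 : coeff a (p, q) = 0 := by
      simp at h1 h2
      tauto
    rw [h0]
    have : (0, 0) ≠ (p, q) := by rintro ⟨⟩; simp at hx
    simp [this]

end Torus

/-! ### Forms generated by exact ones, in a general differential graded algebra. -/

namespace DGAlgebraOver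

variable {k : Type u} [Field k] {A : Type u} [Ring A] [Algebra k A] (Ω : DGAlgebraOver k A)

/-- `dA · A ⊆ A dA`. -/
theorem map_d_mul_grade_zero_le :
    (Ω.grade 0).map Ω.d * Ω.grade 0 ≤ Ω.grade 0 * (Ω.grade 0).map Ω.d := by
  rw [Submodule.mul_le]
  rintro _ ⟨a, ha, rfl⟩ b hb
  have h := Ω.leibniz b ha
  rw [pow_zero, one_mul] at h
  rw [eq_sub_of_add_eq h.symm]
  refine Submodule.sub_mem _ ?_ (Submodule.mul_mem_mul ha ⟨b, hb, rfl⟩)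
  have hab : a * b ∈ Ω.grade 0 := by simpa using SetLike.mul_mem_graded ha hb
  have := Submodule.mul_mem_mul (SetLike.GradedOne.one_mem (A := Ω.grade))
    (Submodule.mem_map_of_mem (f := Ω.d) hab)
  rwa [one_mul] at this

theorem grade_zero_mul_self : Ω.grade 0 * Ω.grade 0 = Ω.grade 0 := by
  refine le_antisymm (Submodule.mul_le.2 fun a ha b hb => ?_) fun a ha => ?_
  · simpa using SetLike.mul_mem_graded ha hb
  · have := Submodule.mul_mem_mul (SetLike.GradedOne.one_mem (A := Ω.grade)) ha
    rwa [one_mul] at this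

/-- `A dA` is stable under left multiplication. -/
theorem mul_mem_grade_zero_mul_map_d {a x : Ω.Form} (ha : a ∈ Ω.grade 0)
    (hx : x ∈ Ω.grade 0 * (Ω.grade 0).map Ω.d) : a * x ∈ Ω.grade 0 * (Ω.grade 0).map Ω.d := by
  have := Submodule.mul_mem_mul ha hx
  rwa [← mul_assoc, grade_zero_mul_self] at this

theorem grade_zero_mul_map_d_mul_grade_zero_le :
    Ω.grade 0 * (Ω.grade 0).map Ω.d * Ω.grade 0 ≤ Ω.grade 0 * (Ω.grade 0).map Ω.d := by
  have h := mul_le_mul' (le_refl (Ω.grade 0)) Ω.map_d_mul_grade_zero_le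
  rwa [← mul_assoc, ← mul_assoc, grade_zero_mul_self] at h

/-- The middle copy of `A` in `A dA · A dA` is moved to the left by the Leibniz rule. This carries
generation from degree one to degree two. -/
theorem grade_zero_mul_map_d_mul_self_le :
    Ω.grade 0 * (Ω.grade 0).map Ω.d * (Ω.grade 0 * (Ω.grade 0).map Ω.d) ≤
      Ω.grade 0 * (Ω.grade 0).map Ω.d ^ 2 := by
  rw [← mul_assoc, pow_two, ← mul_assoc]
  exact mul_le_mul' Ω.grade_zero_mul_map_d_mul_grade_zero_le le_rfl

theorem map_d_pow_le (n : ℕ) : ((Ω.grade 0).map Ω.d) ^ n ≤ Ω.grade n := by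
  induction n with
  | zero =>
    rw [pow_zero, Submodule.one_le]
    exact SetLike.GradedOne.one_mem
  | succ n ih =>
    rw [pow_succ]
    refine (mul_le_mul' ih le_rfl).trans (Submodule.mul_le.2 ?_)
    rintro x hx _ ⟨a, ha, rfl⟩
    exact SetLike.mul_mem_graded hx (Ω.d_mem ha)

theorem grade_zero_mul_map_d_pow_le (n : ℕ) :
    Ω.grade 0 * ((Ω.grade 0).map Ω.d) ^ n ≤ Ω.grade n := by
  refine (mul_le_mul' le_rfl (Ω.map_d_pow_le n)).trans (Submodule.mul_le.2 fun a ha x hx => ?_)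
  simpa using SetLike.mul_mem_graded ha hx

end DGAlgebraOver

/-! ### The pillow forms are a connected calculus of dimension two. -/

namespace PillowForm

variable {θ : ℝ}

/-- The form `(y, 0) ∈ Ω¹`. -/
noncomputable def inV : Minus θ →ₗ[ℂ] PillowForm θ where
  toFun y := mk 0 y 0 0 (by simp) (mem_minus.1 y.2) (by simp) (by simp)
  map_add' y z := by ext <;> simp
  map_smul' c y := by ext <;> simp

/-- The form `(0, y) ∈ Ω¹`. -/
noncomputable def inW : Minus θ →ₗ[ℂ] PillowForm θ where
  toFun y := mk 0 0 y 0 (by simp) (by simp) (mem_minus.1 y.2) (by simp)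
  map_add' y z := by ext <;> simp
  map_smul' c y := by ext <;> simp

/-- The inclusion of `𝒪(ℙ_θ)` as `Ω²`. -/
noncomputable def inTop : Pillow θ →ₗ[ℂ] PillowForm θ where
  toFun a := mk 0 0 0 a (by simp) (by simp) (by simp) (mem_pillow.1 a.2)
  map_add' y z := by ext <;> simp
  map_smul' c y := by ext <;> simp

section components
variable (y : Minus θ) (a : Pillow θ)
@[simp] theorem f0_inV : (inV y).f0 = 0 := rfl
@[simp] theorem fV_inV : (inV y).fV = y := rfl
@[simp] theorem fW_inV : (inV y).fW = 0 := rfl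
@[simp] theorem f2_inV : (inV y).f2 = 0 := rfl
@[simp] theorem f0_inW : (inW y).f0 = 0 := rfl
@[simp] theorem fV_inW : (inW y).fV = 0 := rfl
@[simp] theorem fW_inW : (inW y).fW = y := rfl
@[simp] theorem f2_inW : (inW y).f2 = 0 := rfl
@[simp] theorem f0_inTop : (inTop a).f0 = 0 := rfl
@[simp] theorem fV_inTop : (inTop a).fV = 0 := rfl
@[simp] theorem fW_inTop : (inTop a).fW = 0 := rfl
@[simp] theorem f2_inTop : (inTop a).f2 = a := rfl
@[simp] theorem f0_incl : (incl a).f0 = a := rfl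
@[simp] theorem fV_incl : (incl a).fV = 0 := rfl
@[simp] theorem fW_incl : (incl a).fW = 0 := rfl
@[simp] theorem f2_incl : (incl a).f2 = 0 := rfl
end components

theorem incl_mem_grade (a : Pillow θ) : incl a ∈ grade θ 0 := ⟨rfl, rfl, rfl⟩

/-- `A dA` contains every one-form. -/
theorem grade_one_le (hθ : Irrational θ) : grade θ 1 ≤ grade θ 0 * (grade θ 0).map d := by
  set N := grade θ 0 * (grade θ 0).map d
  have hl : ∀ a : Pillow θ, ∀ x ∈ N, incl a * x ∈ N := fun a x hx =>
    (pillowCalculus θ).mul_mem_grade_zero_mul_map_d (incl_mem_grade a) hx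
  have hr : ∀ a : Pillow θ, ∀ x ∈ N, x * incl a ∈ N := fun a x hx =>
    (pillowCalculus θ).grade_zero_mul_map_d_mul_grade_zero_le
      (Submodule.mul_mem_mul hx (incl_mem_grade a))
  have hd : ∀ a : Pillow θ, d (incl a) ∈ N := by
    intro a
    have h := Submodule.mul_mem_mul (incl_mem_grade (1 : Pillow θ))
      (Submodule.mem_map_of_mem (f := d) (incl_mem_grade a))
    rwa [map_one, one_mul] at h
  -- The odd `y` with `(y, 0) ∈ N` form a subspace stable under the pillow on both sides, so a
  -- single nontrivial member suffices.
  have hV : Minus θ ≤ (N.comap inV).map (Minus θ).subtype := by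
    apply Torus.minus_le_of_odd_one_zero_mem hθ
    · rintro a ha _ ⟨y, hy, rfl⟩
      refine ⟨⟨a * y, Torus.mul_mem_minus_left ha y.2⟩, ?_, rfl⟩
      rw [SetLike.mem_coe, Submodule.mem_comap]
      convert hl ⟨a, ha⟩ _ hy using 1
      ext <;> simp
    · rintro a ha _ ⟨y, hy, rfl⟩
      refine ⟨⟨y * a, Torus.mul_mem_minus_right ha y.2⟩, ?_, rfl⟩
      rw [SetLike.mem_coe, Submodule.mem_comap]
      convert hr ⟨a, ha⟩ _ hy using 1
      ext <;> simp
    · refine ⟨⟨_, Torus.odd_mem 1 0⟩, ?_, rfl⟩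
      rw [SetLike.mem_coe, Submodule.mem_comap]
      -- Here `d (even 1 0) = (i • odd 1 0, 0)`, and `-i` cancels the factor `i`.
      convert N.smul_mem (-Complex.I) (hd ⟨_, Torus.even_mem 1 0⟩) using 1
      ext <;> simp [Torus.derV_even, Torus.derW_even, smul_smul]
  have hW : Minus θ ≤ (N.comap inW).map (Minus θ).subtype := by
    apply Torus.minus_le_of_odd_zero_one_mem hθ
    · rintro a ha _ ⟨y, hy, rfl⟩
      refine ⟨⟨a * y, Torus.mul_mem_minus_left ha y.2⟩, ?_, rfl⟩
      rw [SetLike.mem_coe, Submodule.mem_comap]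
      convert hl ⟨a, ha⟩ _ hy using 1
      ext <;> simp
    · rintro a ha _ ⟨y, hy, rfl⟩
      refine ⟨⟨y * a, Torus.mul_mem_minus_right ha y.2⟩, ?_, rfl⟩
      rw [SetLike.mem_coe, Submodule.mem_comap]
      convert hr ⟨a, ha⟩ _ hy using 1
      ext <;> simp
    · refine ⟨⟨_, Torus.odd_mem 0 1⟩, ?_, rfl⟩
      rw [SetLike.mem_coe, Submodule.mem_comap]
      convert N.smul_mem (-Complex.I) (hd ⟨_, Torus.even_mem 0 1⟩) using 1
      ext <;> simp [Torus.derV_even, Torus.derW_even, smul_smul]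
  rintro x ⟨h0, h2⟩
  obtain ⟨y, hy, hyx⟩ := hV (x := x.fV) x.sigma_fV
  obtain ⟨z, hz, hzx⟩ := hW (x := x.fW) x.sigma_fW
  convert N.add_mem hy hz using 1
  ext <;> simp_all

/-- Since `(y, 0) ∧ (0, z) = yz`, this reduces to every even element being a sum of products of odd
ones. -/
theorem grade_two_le (hθ : Irrational θ) : grade θ 2 ≤ grade θ 1 * grade θ 1 := by
  have h : (Pillow θ).toSubmodule ≤ ((grade θ 1 * grade θ 1).comap inTop).map
      (Pillow θ).val.toLinearMap := by
    refine (Torus.pillow_le_minus_mul_minus hθ).trans (Submodule.mul_le.2 fun y hy z hz => ?_)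
    refine ⟨⟨y * z, Torus.mul_mem_pillow hy hz⟩, ?_, rfl⟩
    rw [SetLike.mem_coe, Submodule.mem_comap]
    convert Submodule.mul_mem_mul (M := grade θ 1) (N := grade θ 1) (m := inV ⟨y, hy⟩)
      (n := inW ⟨z, hz⟩) ⟨rfl, rfl⟩ ⟨rfl, rfl⟩ using 1
    ext <;> simp
  rintro x ⟨h0, hV, hW⟩
  obtain ⟨a, ha, hax⟩ := h (x := x.f2) x.sigma_f2
  rw [SetLike.mem_coe, Submodule.mem_comap] at ha
  convert ha using 1
  ext <;> simp_all

end PillowForm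

theorem pillowCalculus_isCalculus {θ : ℝ} (hθ : Irrational θ) : (pillowCalculus θ).IsCalculus := by
  intro n
  refine le_antisymm ?_ ((pillowCalculus θ).grade_zero_mul_map_d_pow_le n)
  match n with
  | 0 => rw [pow_zero, mul_one]
  | 1 => rw [pow_one]; exact PillowForm.grade_one_le hθ
  | 2 =>
    exact (PillowForm.grade_two_le hθ).trans
      ((mul_le_mul' (PillowForm.grade_one_le hθ) (PillowForm.grade_one_le hθ)).trans
        (pillowCalculus θ).grade_zero_mul_map_d_mul_self_le)
  | n + 3 => exact bot_le

theorem pillowCalculus_hasDimension (θ : ℝ) : (pillowCalculus θ).HasDimension 2 := by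
  refine ⟨fun h => ?_, fun m hm => ?_⟩
  · have h1 : PillowForm.inTop (1 : Pillow θ) ∈ (pillowCalculus θ).grade 2 := ⟨rfl, rfl, rfl⟩
    rw [h] at h1
    have h2 : PillowForm.inTop (1 : Pillow θ) = 0 := h1
    exact one_ne_zero (α := Torus θ) (congrArg PillowForm.f2 h2)
  · obtain ⟨n, rfl⟩ := Nat.exists_eq_add_of_le' hm
    rfl

theorem pillowCalculus_isConnected (θ : ℝ) : (pillowCalculus θ).IsConnected := by
  intro a
  constructor
  · intro h
    obtain ⟨c, hc⟩ := Torus.exists_algebraMap_eq (a := (a : Torus θ))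
      (congrArg PillowForm.fV h) (congrArg PillowForm.fW h)
    exact ⟨c, Subtype.ext hc⟩
  · rintro ⟨c, rfl⟩
    change PillowForm.d (PillowForm.incl _) = 0
    ext
    · rfl
    · exact Torus.der_algebraMap _ _ _
    · exact Torus.der_algebraMap _ _ _
    · rw [PillowForm.f2_d, PillowForm.fV_incl, PillowForm.fW_incl]; simp

/-! ### Integrability from a volume map. -/

namespace DGAlgebraOver

variable {k : Type u} [Field k] {A : Type u} [Ring A] [Algebra k A] {Ω : DGAlgebraOver k A}

/-- The pairing `ω ↦ (η ↦ (-1)ⁱ vol(ω ∧ η))` of `Ωⁱ` with `Ωˡ` given by a right `A`-linear map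
`vol` on forms. -/
def volPairing (vol : Ω.Form →ₗ[k] A) (hr : ∀ x a, vol (x * Ω.ι a) = vol x * a) (i l : ℕ) :
    Ω.grade i →ₗ[k] Ω.IntegralForm l where
  toFun ω :=
    -- The sign `(-1)ⁱ` reconciles the Leibniz rule of `d` with that of a divergence.
    ⟨(-1 : k) ^ i • vol ∘ₗ LinearMap.mulLeft k ω.1 ∘ₗ (Ω.grade l).subtype, fun η a => by
      change (-1 : k) ^ i • vol (ω.1 * (η.1 * Ω.ι a)) = (-1 : k) ^ i • vol (ω.1 * η.1) * a
      rw [← mul_assoc, hr, smul_mul_assoc]⟩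
  map_add' ω ω' := by ext η; simp [add_mul]
  map_smul' c ω := by
    ext η
    change (-1 : k) ^ i • vol (c • ω.1 * η.1) = c • (-1 : k) ^ i • vol (ω.1 * η.1)
    rw [smul_mul_assoc, map_smul, smul_comm]

variable {vol : Ω.Form →ₗ[k] A} {hr : ∀ x a, vol (x * Ω.ι a) = vol x * a}

theorem volPairing_lmul_rmul (hl : ∀ a x, vol (Ω.ι a * x) = a * vol x) {i l : ℕ} (a b : A)
    (ω : Ω.grade i) : volPairing vol hr i l (lmul a (rmul ω b)) =
      leftAct a (rightAct (volPairing vol hr i l ω) b) := by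
  ext η
  change (-1 : k) ^ i • vol (Ω.ι a * (ω.1 * Ω.ι b) * η.1)
    = a * ((-1 : k) ^ i • vol (ω.1 * (Ω.ι b * η.1)))
  rw [mul_assoc, hl, mul_assoc, mul_smul_comm]

theorem volPairing_rmul {i l : ℕ} (b : A)
    (ω : Ω.grade i) : volPairing vol hr i l (rmul ω b) = rightAct (volPairing vol hr i l ω) b := by
  ext η
  change (-1 : k) ^ i • vol (ω.1 * Ω.ι b * η.1) = (-1 : k) ^ i • vol (ω.1 * (Ω.ι b * η.1))
  rw [mul_assoc]

/-- The divergence `vol ∘ d` transported to integral one-forms by the pairing. -/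
noncomputable def volDivergence (hb : Function.Bijective (volPairing vol hr 1 1)) :
    Ω.Divergence where
  -- For these pairings the choice is forced: evaluate `Θ₂ ∘ d = ∇ ∘ Θ₁` at `1`.
  toLin := vol ∘ₗ Ω.d ∘ₗ (Ω.grade 1).subtype ∘ₗ (LinearEquiv.ofBijective _ hb).symm.toLinearMap
  leibniz φ a := by
    obtain ⟨ω, rfl⟩ := (LinearEquiv.ofBijective _ hb).surjective φ
    have h : rightAct (LinearEquiv.ofBijective _ hb ω) a
        = LinearEquiv.ofBijective _ hb (rmul ω a) := (volPairing_rmul (hr := hr) a ω).symm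
    rw [h]
    simp only [LinearMap.comp_apply, LinearEquiv.coe_coe, LinearEquiv.symm_apply_apply]
    change vol (Ω.d (ω.1 * Ω.ι a)) = vol (Ω.d ω.1) * a + (-1 : k) ^ 1 • vol (ω.1 * Ω.d (Ω.ι a))
    rw [Ω.leibniz _ ω.2, map_add, hr]
    simp

theorem volDivergence_volPairing (hb : Function.Bijective (volPairing vol hr 1 1))
    (ω : Ω.grade 1) : (volDivergence hb).toLin (volPairing vol hr 1 1 ω) = vol (Ω.d ω.1) := by
  change vol (Ω.d ((LinearEquiv.ofBijective _ hb).symm (LinearEquiv.ofBijective _ hb ω)).1) = _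
  rw [LinearEquiv.symm_apply_apply]

/-- At a 0-form `η` the left side is `vol (d (ωη)) + vol (ω dη)`; as `ω` has degree one, the Leibniz
rule leaves `vol (dω η)`. -/
theorem volDivergence_ext_zero (hb : Function.Bijective (volPairing vol hr 1 1)) (ω : Ω.grade 1) :
    (volDivergence hb).ext 0 (volPairing vol hr 1 1 ω) = volPairing vol hr 2 0 (Ω.dGrade 1 ω) := by
  ext η
  change (volDivergence hb).toLin (formAct (n := 0) (m := 1) (volPairing vol hr 1 1 ω) η)
    + (-1) ^ 1 * ((-1 : k) ^ 1 • vol (ω.1 * Ω.d η.1)) = (-1 : k) ^ 2 • vol (Ω.d ω.1 * η.1)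
  have h : formAct (n := 0) (m := 1) (volPairing vol hr 1 1 ω) η
      = volPairing vol hr 1 1 (wedge (m := 1) (n := 0) ω η) := by
    ext ζ
    change (-1 : k) ^ 1 • vol (ω.1 * (η.1 * ζ.1)) = (-1 : k) ^ 1 • vol (ω.1 * η.1 * ζ.1)
    rw [mul_assoc]
  rw [h, volDivergence_volPairing]
  change vol (Ω.d (ω.1 * η.1)) + _ = _
  rw [Ω.leibniz _ ω.2]
  simp

/-- Contracting the image of `ω` with a one-form `η` gives minus the image of `ωη`. Hence the left
side at `η` is `-vol (d (ωη)) + vol (ω dη) = -vol (dω η)`. -/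
theorem volDivergence_ext_one
    (hb : Function.Bijective (volPairing vol hr 1 1)) (ω : Ω.grade 0) :
    (volDivergence hb).ext 1 (volPairing vol hr 0 2 ω) = volPairing vol hr 1 1 (Ω.dGrade 0 ω) := by
  ext η
  change (volDivergence hb).toLin (formAct (n := 1) (m := 1) (volPairing vol hr 0 2 ω) η)
    + (-1) ^ 2 * ((-1 : k) ^ 0 • vol (ω.1 * Ω.d η.1)) = (-1 : k) ^ 1 • vol (Ω.d ω.1 * η.1)
  have h : formAct (n := 1) (m := 1) (volPairing vol hr 0 2 ω) η
      = (-1 : k) • volPairing vol hr 1 1 ⟨ω.1 * η.1, by simpa using SetLike.mul_mem_graded ω.2 η.2⟩ := by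
    ext ζ
    change (-1 : k) ^ 0 • vol (ω.1 * (η.1 * ζ.1)) = (-1 : k) • (-1 : k) ^ 1 • vol (ω.1 * η.1 * ζ.1)
    rw [mul_assoc]
    simp
  rw [h, map_smul, volDivergence_volPairing, Ω.leibniz _ ω.2]
  simp

/-- A differential graded algebra with a bimodule map `vol` to `A`, for which all pairings
`(ω, η) ↦ vol(ω ∧ η)` of forms of complementary degree are perfect, is integrable. -/
theorem isIntegrable_two_of_volume (vol : Ω.Form →ₗ[k] A)
    (hr : ∀ x a, vol (x * Ω.ι a) = vol x * a) (hl : ∀ a x, vol (Ω.ι a * x) = a * vol x)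
    (hb : ∀ i l, i + l = 2 → Function.Bijective (volPairing vol hr i l)) : Ω.IsIntegrable 2 := by
  -- No twist is needed, because `vol` is linear over `A` on the left as well.
  refine ⟨volDivergence (hb 1 1 rfl), AlgEquiv.refl,
    fun i l h => LinearEquiv.ofBijective _ (hb i l h), ?_, ?_, ?_⟩
  · intro φ
    obtain ⟨ω, rfl⟩ := (hb 0 2 rfl).2 φ
    rw [volDivergence_ext_one, volDivergence_volPairing]
    change vol (Ω.d (Ω.d ω.1)) = 0
    rw [Ω.d_d, map_zero]
  · intro i l h a b ω
    exact volPairing_lmul_rmul (hr := hr) hl a b ω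
  · intro i l h ω
    obtain ⟨rfl, rfl⟩ | ⟨rfl, rfl⟩ : i = 0 ∧ l = 1 ∨ i = 1 ∧ l = 0 := by omega
    · exact (volDivergence_ext_one (hb 1 1 rfl) ω).symm
    · exact (volDivergence_ext_zero (hb 1 1 rfl) ω).symm

end DGAlgebraOver

/-! ### Perfectness of the pairings for the pillow. -/

namespace Torus

variable {θ : ℝ}

/-- With `1 = ∑ sᵢtᵢ` one has `m = ∑ (m sᵢ) tᵢ = 0`. -/
theorem eq_zero_of_forall_mul_minus (hθ : Irrational θ) {m : Torus θ}
    (h : ∀ y ∈ Minus θ, m * y = 0) : m = 0 := by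
  have key : ∀ a ∈ Minus θ * Minus θ, m * a = 0 := by
    intro a ha
    induction ha using Submodule.mul_induction_on' with
    | mem_mul_mem y hy z hz => rw [← mul_assoc, h y hy, zero_mul]
    | add x _ y _ hx hy => rw [mul_add, hx, hy, add_zero]
  simpa using key 1 (one_mem_minus_mul_minus hθ)

/-- A right linear map from `𝒪(𝕋²_θ)₋` to `𝒪(ℙ_θ)` is the left multiplication by an element of
`𝒪(𝕋²_θ)₋`. -/
theorem exists_eq_mul_of_right_linear (hθ : Irrational θ) (f : Minus θ →ₗ[ℂ] Pillow θ)
    (hf : ∀ (y : Minus θ) (a : Pillow θ), f ⟨y * a, mul_mem_minus_right a.2 y.2⟩ = f y * a) :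
    ∃ m : Minus θ, ∀ y : Minus θ, (f y : Torus θ) = m * y := by
  -- For odd `s`, `t`, `y` the product `ty` is even, so `f (sty) = f s * t * y`, and `f s * t` is
  -- the multiplier for `a = st`; sums follow, and then `a = 1`. The separate variable `z` keeps the
  -- membership proof for `a * y` out of the statement.
  have key : ∀ a ∈ Minus θ * Minus θ, ∃ m : Minus θ, ∀ y z : Minus θ, (z : Torus θ) = a * y →
      (f z : Torus θ) = m * y := by
    intro a ha
    induction ha using Submodule.mul_induction_on' with
    | mem_mul_mem s hs t ht =>
      refine ⟨⟨f ⟨s, hs⟩ * t, mul_mem_minus_left (f ⟨s, hs⟩).2 ht⟩, fun y z h => ?_⟩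
      have h1 := hf ⟨s, hs⟩ ⟨t * y, mul_mem_pillow ht y.2⟩
      have h2 : z = ⟨s * (t * y), mul_mem_minus_right (mul_mem_pillow ht y.2) hs⟩ :=
        Subtype.ext (by rw [h, mul_assoc])
      rw [h2, h1]
      simp [mul_assoc]
    | add s hs t ht h1 h2 =>
      obtain ⟨m, hm⟩ := h1
      obtain ⟨n, hn⟩ := h2
      have hle : Minus θ * Minus θ ≤ (Pillow θ).toSubmodule :=
        Submodule.mul_le.2 fun y hy z hz => mul_mem_pillow hy hz
      refine ⟨m + n, fun y z h => ?_⟩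
      have h3 : z = ⟨s * y, mul_mem_minus_left (hle hs) y.2⟩
          + ⟨t * y, mul_mem_minus_left (hle ht) y.2⟩ :=
        Subtype.ext (by rw [h, add_mul]; rfl)
      rw [h3, map_add]
      push_cast
      rw [hm y _ rfl, hn y _ rfl, add_mul]
  obtain ⟨m, hm⟩ := key 1 (one_mem_minus_mul_minus hθ)
  exact ⟨m, fun y => hm y y (one_mul _).symm⟩

end Torus

section Pillow

variable {θ : ℝ}

/-- The projection of forms on `Ω² = 𝒪(ℙ_θ)`. -/
noncomputable def pillowVolume (θ : ℝ) : (pillowCalculus θ).Form →ₗ[ℂ] Pillow θ where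
  toFun x := ⟨PillowForm.f2 x, PillowForm.sigma_f2 x⟩
  map_add' _ _ := rfl
  map_smul' _ _ := rfl

theorem pillowVolume_mul_ι (x : (pillowCalculus θ).Form) (a : Pillow θ) :
    pillowVolume θ (x * (pillowCalculus θ).ι a) = pillowVolume θ x * a := by
  apply Subtype.ext
  change PillowForm.f0 x * 0 + (PillowForm.fV x * 0 - PillowForm.fW x * 0)
    + PillowForm.f2 x * (a : Torus θ) = PillowForm.f2 x * (a : Torus θ)
  simp

theorem pillowVolume_ι_mul (a : Pillow θ) (x : (pillowCalculus θ).Form) :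
    pillowVolume θ ((pillowCalculus θ).ι a * x) = a * pillowVolume θ x := by
  apply Subtype.ext
  change (a : Torus θ) * PillowForm.f2 x + (0 * PillowForm.fW x - 0 * PillowForm.fV x)
    + 0 * PillowForm.f0 x = (a : Torus θ) * PillowForm.f2 x
  simp

theorem volPairing_pillow_apply {i l : ℕ} (ω : (pillowCalculus θ).grade i)
    (η : (pillowCalculus θ).grade l) :
    ((DGAlgebraOver.volPairing (pillowVolume θ) pillowVolume_mul_ι i l ω).1 η : Torus θ)
      = (-1 : ℂ) ^ i • (PillowForm.f0 ω.1 * PillowForm.f2 η.1 +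
        (PillowForm.fV ω.1 * PillowForm.fW η.1 - PillowForm.fW ω.1 * PillowForm.fV η.1) +
        PillowForm.f2 ω.1 * PillowForm.f0 η.1) := rfl

/-- `Ω²` is a free right module on the element `1`, so a right linear map is determined by its value
there. The pairing of degrees two and zero is handled in the same way, with `1 ∈ Ω⁰`. -/
theorem volPairing_pillow_bijective_zero_two : Function.Bijective
    (DGAlgebraOver.volPairing (pillowVolume θ) pillowVolume_mul_ι 0 2) := by
  let e : (pillowCalculus θ).grade 2 := ⟨PillowForm.inTop 1, rfl, rfl, rfl⟩
  have he : PillowForm.f2 e.1 = (1 : Torus θ) := rfl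
  constructor
  · rw [injective_iff_map_eq_zero]
    rintro ⟨x, hV, hW, h2⟩ h
    have h1 := congrArg (fun φ : (pillowCalculus θ).IntegralForm 2 => (φ.1 e : Torus θ)) h
    simp only [volPairing_pillow_apply, he, hV, hW, h2] at h1
    have h0 : PillowForm.f0 x = 0 := by simpa using h1
    exact Subtype.ext (PillowForm.ext h0 hV hW h2)
  · intro φ
    refine ⟨⟨PillowForm.incl (φ.1 e), rfl, rfl, rfl⟩, ?_⟩
    ext η
    have h1 := φ.2 e ⟨PillowForm.f2 η.1, PillowForm.sigma_f2 _⟩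
    have h2 : η = DGAlgebraOver.rmul e ⟨PillowForm.f2 η.1, PillowForm.sigma_f2 _⟩ := by
      obtain ⟨h0, hV, hW⟩ := η.2
      refine Subtype.ext (PillowForm.ext ?_ ?_ ?_ ?_)
      · refine h0.trans ?_
        change 0 = (0 : Torus θ) * _
        simp
      · refine hV.trans ?_
        change 0 = (0 : Torus θ) * _ + 0 * _
        simp
      · refine hW.trans ?_
        change 0 = (0 : Torus θ) * _ + 0 * _
        simp
      · change PillowForm.f2 η.1 = (0 : Torus θ) * _ + (0 * _ - 0 * _) + 1 * PillowForm.f2 η.1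
        simp
    rw [volPairing_pillow_apply]
    conv_rhs => rw [h2, h1]
    change (-1 : ℂ) ^ 0 • ((φ.1 e : Torus θ) * PillowForm.f2 η.1 + (0 * _ - 0 * _) + 0 * _) = _
    simp

theorem volPairing_pillow_bijective_two_zero : Function.Bijective
    (DGAlgebraOver.volPairing (pillowVolume θ) pillowVolume_mul_ι 2 0) := by
  let e : (pillowCalculus θ).grade 0 := ⟨PillowForm.incl 1, rfl, rfl, rfl⟩
  have he : PillowForm.f0 e.1 = (1 : Torus θ) := rfl
  constructor
  · rw [injective_iff_map_eq_zero]
    rintro ⟨x, h0, hV, hW⟩ h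
    have h1 := congrArg (fun φ : (pillowCalculus θ).IntegralForm 0 => (φ.1 e : Torus θ)) h
    simp only [volPairing_pillow_apply, he, hV, hW, h0] at h1
    have h2 : PillowForm.f2 x = 0 := by simpa using h1
    exact Subtype.ext (PillowForm.ext h0 hV hW h2)
  · intro φ
    refine ⟨⟨PillowForm.inTop (φ.1 e), rfl, rfl, rfl⟩, ?_⟩
    ext η
    have h1 := φ.2 e ⟨PillowForm.f0 η.1, PillowForm.sigma_f0 _⟩
    have h2 : η = DGAlgebraOver.rmul e ⟨PillowForm.f0 η.1, PillowForm.sigma_f0 _⟩ := by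
      obtain ⟨hV, hW, h2⟩ := η.2
      refine Subtype.ext (PillowForm.ext ?_ ?_ ?_ ?_)
      · change PillowForm.f0 η.1 = 1 * PillowForm.f0 η.1
        simp
      · refine hV.trans ?_
        change 0 = (1 : Torus θ) * 0 + 0 * _
        simp
      · refine hW.trans ?_
        change 0 = (1 : Torus θ) * 0 + 0 * _
        simp
      · refine h2.trans ?_
        change 0 = (1 : Torus θ) * 0 + (0 * _ - 0 * _) + 0 * _
        simp
    rw [volPairing_pillow_apply]
    conv_rhs => rw [h2, h1]
    change (-1 : ℂ) ^ 2 • (0 * _ + (0 * _ - 0 * _) + (φ.1 e : Torus θ) * PillowForm.f0 η.1) = _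
    simp

theorem volPairing_pillow_bijective_one_one (hθ : Irrational θ) : Function.Bijective
    (DGAlgebraOver.volPairing (pillowVolume θ) pillowVolume_mul_ι 1 1) := by
  let inV : Minus θ →ₗ[ℂ] (pillowCalculus θ).grade 1 :=
    PillowForm.inV.codRestrict (PillowForm.grade θ 1) fun _ => ⟨rfl, rfl⟩
  let inW : Minus θ →ₗ[ℂ] (pillowCalculus θ).grade 1 :=
    PillowForm.inW.codRestrict (PillowForm.grade θ 1) fun _ => ⟨rfl, rfl⟩
  constructor
  · rw [injective_iff_map_eq_zero]
    rintro ⟨x, h0, h2⟩ h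
    have hV : PillowForm.fV x = 0 := by
      refine Torus.eq_zero_of_forall_mul_minus hθ fun y hy => ?_
      have h1 := congrArg (fun φ : (pillowCalculus θ).IntegralForm 1 =>
        (φ.1 (inW ⟨y, hy⟩) : Torus θ)) h
      change (-1 : ℂ) ^ 1 • (_ * 0 + (PillowForm.fV x * y - _ * 0) + _ * 0) = (0 : Torus θ) at h1
      simpa using h1
    have hW : PillowForm.fW x = 0 := by
      refine Torus.eq_zero_of_forall_mul_minus hθ fun y hy => ?_
      have h1 := congrArg (fun φ : (pillowCalculus θ).IntegralForm 1 =>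
        (φ.1 (inV ⟨y, hy⟩) : Torus θ)) h
      change (-1 : ℂ) ^ 1 • (_ * 0 + (_ * 0 - PillowForm.fW x * y) + _ * 0) = (0 : Torus θ) at h1
      simpa using h1
    exact Subtype.ext (PillowForm.ext h0 hV hW h2)
  · intro φ
    obtain ⟨m, hm⟩ := Torus.exists_eq_mul_of_right_linear hθ (φ.1 ∘ₗ inV) fun y a => by
      refine Eq.trans (congrArg φ.1 (Subtype.ext ?_)) (φ.2 (inV y) a)
      refine PillowForm.ext ?_ ?_ ?_ ?_
      · change 0 = (0 : Torus θ) * _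
        simp
      · change (y * a : Torus θ) = 0 * 0 + y * a
        simp
      · change 0 = (0 : Torus θ) * 0 + 0 * a
        simp
      · change 0 = (0 : Torus θ) * 0 + (y * 0 - 0 * 0) + 0 * a
        simp
    obtain ⟨n, hn⟩ := Torus.exists_eq_mul_of_right_linear hθ (φ.1 ∘ₗ inW) fun y a => by
      refine Eq.trans (congrArg φ.1 (Subtype.ext ?_)) (φ.2 (inW y) a)
      refine PillowForm.ext ?_ ?_ ?_ ?_
      · change 0 = (0 : Torus θ) * _
        simp
      · change 0 = (0 : Torus θ) * 0 + 0 * a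
        simp
      · change (y * a : Torus θ) = 0 * 0 + y * a
        simp
      · change 0 = (0 : Torus θ) * 0 + (0 * 0 - y * 0) + 0 * a
        simp
    -- The wedge pairs the `V`-slot of one form with the `W`-slot of the other, so the multipliers
    -- `m`, `n` change places; the signs come from the wedge and from `(-1)¹`.
    refine ⟨-inV n + inW m, ?_⟩
    ext η
    have h1 : η = inV ⟨PillowForm.fV η.1, PillowForm.sigma_fV _⟩
        + inW ⟨PillowForm.fW η.1, PillowForm.sigma_fW _⟩ := by
      obtain ⟨h0, h2⟩ := η.2
      refine Subtype.ext (PillowForm.ext ?_ ?_ ?_ ?_)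
      · refine h0.trans ?_
        change 0 = (0 : Torus θ) + 0
        simp
      · change PillowForm.fV η.1 = PillowForm.fV η.1 + 0
        simp
      · change PillowForm.fW η.1 = 0 + PillowForm.fW η.1
        simp
      · refine h2.trans ?_
        change 0 = (0 : Torus θ) + 0
        simp
    have hV := hm ⟨PillowForm.fV η.1, PillowForm.sigma_fV _⟩
    have hW := hn ⟨PillowForm.fW η.1, PillowForm.sigma_fW _⟩
    rw [LinearMap.comp_apply] at hV hW
    conv_rhs => rw [h1, map_add]
    push_cast
    rw [hV, hW]
    change (-1 : ℂ) ^ 1 • ((-0 + 0) * PillowForm.f2 η.1 + ((-(n : Torus θ) + 0) * PillowForm.fW η.1 -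
      (-0 + (m : Torus θ)) * PillowForm.fV η.1) + (-0 + 0) * PillowForm.f0 η.1) = _
    simp [add_comm]

theorem pillowCalculus_isIntegrable (hθ : Irrational θ) : (pillowCalculus θ).IsIntegrable 2 := by
  refine DGAlgebraOver.isIntegrable_two_of_volume (pillowVolume θ) pillowVolume_mul_ι
    pillowVolume_ι_mul fun i l h => ?_
  obtain ⟨rfl, rfl⟩ | ⟨rfl, rfl⟩ | ⟨rfl, rfl⟩ :
    i = 0 ∧ l = 2 ∨ i = 1 ∧ l = 1 ∨ i = 2 ∧ l = 0 := by omega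
  · exact volPairing_pillow_bijective_zero_two
  · exact volPairing_pillow_bijective_one_one hθ
  · exact volPairing_pillow_bijective_two_zero

end Pillow

/-! ### Growth inside the torus algebra. -/

namespace Torus

variable {θ : ℝ}

/-- The two orders of multiplication combine `even (p + 1) q` and `even (p - 1) q` with determinant
`λ^(-q) - λ^q`. This gives a climb in `p` along any row `q ≠ 0`, using one more factor `even 1 0` at
each step. -/
theorem even_add_one_left_mem (hθ : Irrational θ) {S : Submodule ℂ (Torus θ)} {p q : ℤ}
    (hq : q ≠ 0) (h1 : even p q * even 1 0 ∈ S) (h2 : even 1 0 * even p q ∈ S) :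
    even (p + 1) q ∈ S := by
  rw [even_mul_even] at h1 h2
  rw [show 1 - p = -(p - 1) by ring, show 0 - q = -(q - 0) by ring, even_neg, add_comm 1 p,
    zero_add, zero_mul] at h2
  simp only [add_zero] at h1 h2
  refine S.left_mem_of_det_ne_zero h1 h2 ?_
  simpa [sub_eq_zero] using torusParam_zpow_neg_ne hθ hq

theorem even_add_one_right_mem (hθ : Irrational θ) {S : Submodule ℂ (Torus θ)} {p q : ℤ}
    (hp : p ≠ 0) (h1 : even p q * even 0 1 ∈ S) (h2 : even 0 1 * even p q ∈ S) :
    even p (q + 1) ∈ S := by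
  rw [even_mul_even] at h1 h2
  rw [show 1 - q = -(q - 1) by ring, show 0 - p = -(p - 0) by ring, even_neg, add_comm 1 q,
    zero_add, one_mul] at h2
  simp only [add_zero] at h1 h2
  refine S.left_mem_of_det_ne_zero h1 h2 ?_
  simpa [sub_eq_zero] using (torusParam_zpow_neg_ne hθ hp).symm

/-- If `V + V*` and `W + W*` lie in `X`, then `VᵖWᑫ + V⁻ᵖW⁻ᑫ` is a combination of words of length
`p + q` in elements of `X`. -/
theorem even_mem_pow (hθ : Irrational θ) {X : Submodule ℂ (Torus θ)} (hV : even 1 0 ∈ X)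
    (hW : even 0 1 ∈ X) (p q : ℕ) :
    (even (p + 1 : ℕ) (q + 1 : ℕ) : Torus θ) ∈ X ^ (p + 1 + (q + 1)) := by
  -- Row `1` is climbed from `even 0 1`; the columns are climbed afterwards, which is possible
  -- because their index `p + 1` is nonzero.
  have h1 : ∀ p : ℕ, (even p 1 : Torus θ) ∈ X ^ (p + 1) := by
    intro p
    induction p with
    | zero => simpa using hW
    | succ p ih =>
      push_cast
      refine even_add_one_left_mem hθ one_ne_zero ?_ ?_
      · rw [pow_succ]; exact Submodule.mul_mem_mul ih hV
      · rw [pow_succ']; exact Submodule.mul_mem_mul hV ih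
  induction q with
  | zero => simpa using h1 (p + 1)
  | succ q ih =>
    rw [Nat.cast_succ (q + 1)]
    refine even_add_one_right_mem hθ (by positivity) ?_ ?_
    · rw [← add_assoc (p + 1), pow_succ]; exact Submodule.mul_mem_mul ih hW
    · rw [← add_assoc (p + 1), pow_succ']; exact Submodule.mul_mem_mul hW ih

/-- With positive exponents the mirror monomial of one element never occurs in another, so a single
coefficient isolates each scalar. -/
theorem linearIndependent_even (m : ℕ) : LinearIndependent ℂ fun x : Fin m × Fin m =>
    (even ((x.1 + 1 : ℕ) : ℤ) ((x.2 + 1 : ℕ) : ℤ) : Torus θ) := by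
  rw [linearIndependent_iff']
  intro s g hg x hx
  have h := congrArg (fun a => coeff a (((x.1 + 1 : ℕ) : ℤ), ((x.2 + 1 : ℕ) : ℤ))) hg
  simp only [map_sum, map_smul, even, map_add, coeff_mon, map_zero, Finsupp.coe_finsetSum,
    Finset.sum_apply, Finsupp.smul_apply, Finsupp.add_apply, Finsupp.single_apply, Prod.mk.injEq,
    Finsupp.coe_zero, Pi.zero_apply] at h
  rw [Finset.sum_eq_single_of_mem x hx] at h
  · have : ¬ -(((x.1 : ℕ) + 1 : ℕ) : ℤ) = (((x.1 : ℕ) + 1 : ℕ) : ℤ) := by omega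
    rw [if_pos ⟨rfl, rfl⟩, if_neg (fun h => this h.1)] at h
    simpa using h
  · intro y _ hy
    have h1 : ¬ ((((y.1 : ℕ) + 1 : ℕ) : ℤ) = (((x.1 : ℕ) + 1 : ℕ) : ℤ) ∧
        (((y.2 : ℕ) + 1 : ℕ) : ℤ) = (((x.2 : ℕ) + 1 : ℕ) : ℤ)) := by
      rintro ⟨h1, h2⟩
      exact hy (Prod.ext (Fin.ext (by omega)) (Fin.ext (by omega)))
    have h2 : ¬ -(((y.1 : ℕ) + 1 : ℕ) : ℤ) = (((x.1 : ℕ) + 1 : ℕ) : ℤ) := by omega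
    rw [if_neg h1, if_neg (fun h => h2 h.1)]
    simp

/-- The span of the `VᵐWⁿ` with `|m|, |n| ≤ K`. -/
noncomputable def box (θ : ℝ) (K : ℕ) : Submodule ℂ (Torus θ) :=
  Submodule.span ℂ ((fun x : ℤ × ℤ => (mon x.1 x.2 : Torus θ)) ''
    (Finset.Icc (-K : ℤ) K ×ˢ Finset.Icc (-K : ℤ) K : Finset (ℤ × ℤ)))

theorem mon_mem_box {K : ℕ} {m n : ℤ} (hm : |m| ≤ K) (hn : |n| ≤ K) : mon m n ∈ box θ K :=
  Submodule.subset_span ⟨(m, n), by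
    simp only [Finset.coe_product, Finset.coe_Icc, Set.mem_prod, Set.mem_Icc]
    exact ⟨abs_le.1 hm, abs_le.1 hn⟩, rfl⟩

theorem box_le {K : ℕ} {S : Submodule ℂ (Torus θ)}
    (h : ∀ m n : ℤ, |m| ≤ K → |n| ≤ K → mon m n ∈ S) : box θ K ≤ S := by
  refine Submodule.span_le.2 ?_
  rintro _ ⟨⟨m, n⟩, hx, rfl⟩
  simp only [Finset.coe_product, Finset.coe_Icc, Set.mem_prod, Set.mem_Icc] at hx
  exact h m n (abs_le.2 hx.1) (abs_le.2 hx.2)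

theorem box_mono {K L : ℕ} (h : K ≤ L) : box θ K ≤ box θ L :=
  box_le fun _ _ hm hn => mon_mem_box (hm.trans (by exact_mod_cast h)) (hn.trans (by exact_mod_cast h))

theorem box_mul_box_le (K L : ℕ) : box θ K * box θ L ≤ box θ (K + L) := by
  refine Submodule.mul_le.2 fun a ha b hb => ?_
  refine box_le (S := (box θ (K + L)).comap (LinearMap.mulRight ℂ b)) (fun m n hm hn => ?_) ha
  refine box_le (S := (box θ (K + L)).comap (LinearMap.mulLeft ℂ (mon m n)))
    (fun p q hp hq => ?_) hb
  rw [Submodule.mem_comap, LinearMap.mulLeft_apply, mon_mul_mon]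
  refine Submodule.smul_mem _ _ (mon_mem_box ?_ ?_)
  · push_cast; exact (abs_add_le _ _).trans (add_le_add hm hp)
  · push_cast; exact (abs_add_le _ _).trans (add_le_add hn hq)

theorem one_le_box (K : ℕ) : 1 ≤ box θ K := by
  rw [Submodule.one_le, ← mon_zero_zero]
  exact mon_mem_box (by simp) (by simp)

theorem box_pow_le (K n : ℕ) : box θ K ^ n ≤ box θ (n * K) := by
  induction n with
  | zero => rw [pow_zero]; exact one_le_box _
  | succ n ih =>
    rw [pow_succ, Nat.succ_mul]
    exact (mul_le_mul' ih le_rfl).trans (box_mul_box_le _ _)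

instance (K : ℕ) : FiniteDimensional ℂ (box θ K) :=
  FiniteDimensional.span_of_finite ℂ ((Finset.finite_toSet _).image _)

theorem finrank_box_le (K : ℕ) : Module.finrank ℂ (box θ K) ≤ (2 * K + 1) ^ 2 := by
  classical
  rw [box, ← Finset.coe_image]
  refine (finrank_span_finset_le_card _).trans (Finset.card_image_le.trans ?_)
  rw [Finset.card_product, Int.card_Icc, pow_two]
  have : (K + 1 - -K : ℤ).toNat = 2 * K + 1 := by omega
  rw [this]

theorem exists_mem_box (a : Torus θ) : ∃ K, a ∈ box θ K := by
  have h : a ∈ Submodule.span ℂ (Set.range fun x : ℤ × ℤ => (mon x.1 x.2 : Torus θ)) := by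
    rw [span_mon]; trivial
  induction h using Submodule.span_induction with
  | mem a h =>
    obtain ⟨x, rfl⟩ := h
    refine ⟨x.1.natAbs + x.2.natAbs, mon_mem_box ?_ ?_⟩ <;> rw [Int.abs_eq_natAbs] <;> omega
  | zero => exact ⟨0, Submodule.zero_mem _⟩
  | add a b _ _ ha hb =>
    obtain ⟨K, hK⟩ := ha
    obtain ⟨L, hL⟩ := hb
    exact ⟨K + L, Submodule.add_mem _ (box_mono (by omega) hK) (box_mono (by omega) hL)⟩
  | smul c a _ ha =>
    obtain ⟨K, hK⟩ := ha
    exact ⟨K, Submodule.smul_mem _ _ hK⟩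

theorem exists_le_box {V : Submodule ℂ (Torus θ)} (hV : V.FG) : ∃ K, V ≤ box θ K := by
  induction V, hV using Submodule.fg_induction with
  | singleton a =>
    obtain ⟨K, hK⟩ := exists_mem_box a
    exact ⟨K, (Submodule.span_singleton_le_iff_mem _ _).2 hK⟩
  | sup V W _ _ hV hW =>
    obtain ⟨K, hK⟩ := hV
    obtain ⟨L, hL⟩ := hW
    exact ⟨K + L, sup_le (hK.trans (box_mono (by omega))) (hL.trans (box_mono (by omega)))⟩

end Torus

/-! ### Growth exponents from polynomial bounds on dimensions. -/

section Growth

variable {k : Type u} [Field k] {A : Type u} [Ring A] [Algebra k A]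

/-- Every element of the algebra generated by `V` is a combination of words of bounded length. -/
theorem exists_mem_one_sup_pow {V : Submodule k A} (hV : Algebra.adjoin k (V : Set A) = ⊤) (a : A) :
    ∃ N, a ∈ (1 ⊔ V) ^ N := by
  have h : a ∈ Algebra.adjoin k (V : Set A) := by rw [hV]; trivial
  have hmono : ∀ {m n : ℕ}, m ≤ n → (1 ⊔ V) ^ m ≤ (1 ⊔ V) ^ n :=
    fun h => pow_le_pow_right' le_sup_left h
  induction h using Algebra.adjoin_induction with
  | mem x hx => exact ⟨1, by rw [pow_one]; exact Submodule.mem_sup_right hx⟩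
  | algebraMap c => exact ⟨0, by rw [pow_zero]; exact Submodule.algebraMap_mem c⟩
  | add x y _ _ hx hy =>
    obtain ⟨m, hm⟩ := hx
    obtain ⟨n, hn⟩ := hy
    exact ⟨m + n, Submodule.add_mem _ (hmono (by omega) hm) (hmono (by omega) hn)⟩
  | mul x y _ _ hx hy =>
    obtain ⟨m, hm⟩ := hx
    obtain ⟨n, hn⟩ := hy
    exact ⟨m + n, by rw [pow_add]; exact Submodule.mul_mem_mul hm hn⟩

/-- Every `ν > d` is admissible, since `n ^ (ν - d)` eventually exceeds `C`. -/
theorem growthExponent_le_of_finrank_le {V : Submodule k A} {C d : ℕ}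
    (h : ∀ n : ℕ, 1 ≤ n → Module.finrank k ((1 ⊔ V) ^ n : Submodule k A) ≤ C * n ^ d) :
    growthExponent k V ≤ ((d : ℝ) : EReal) := by
  refine EReal.le_of_forall_lt_iff_le.1 fun ν hν => sInf_le ⟨ν, ?_, rfl⟩
  have hν' : (0 : ℝ) < ν - d := by
    rw [sub_pos]; exact_mod_cast hν
  have h1 : Tendsto (fun n : ℕ => (n : ℝ) ^ (ν - d)) atTop atTop :=
    (tendsto_rpow_atTop hν').comp tendsto_natCast_atTop_atTop
  filter_upwards [h1.eventually_ge_atTop (C : ℝ), eventually_ge_atTop 1] with n hn hn1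
  have hpos : (0 : ℝ) < n := by exact_mod_cast hn1
  calc (Module.finrank k ((1 ⊔ V) ^ n : Submodule k A) : ℝ) ≤ C * (n : ℝ) ^ d := by
        exact_mod_cast h n hn1
    _ ≤ (n : ℝ) ^ (ν - d) * (n : ℝ) ^ d := by gcongr
    _ = (n : ℝ) ^ ν := by
        rw [← Real.rpow_natCast, ← Real.rpow_add hpos, sub_add_cancel]

/-- An admissible `ν < d`, evaluated at length `C * n`, would give `n ^ d ≤ C ^ ν * n ^ ν` for all
large `n`. -/
theorem le_growthExponent_of_le_finrank {V : Submodule k A} {C d : ℕ} (hC : 0 < C)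
    (h : ∀ n : ℕ, n ^ d ≤ Module.finrank k ((1 ⊔ V) ^ (C * n) : Submodule k A)) :
    ((d : ℝ) : EReal) ≤ growthExponent k V := by
  refine le_sInf ?_
  rintro _ ⟨ν, hν, rfl⟩
  rw [EReal.coe_le_coe_iff]
  by_contra! hlt
  have hν' : (0 : ℝ) < d - ν := sub_pos.2 hlt
  have h1 : Tendsto (fun n : ℕ => (n : ℝ) ^ (d - ν)) atTop atTop :=
    (tendsto_rpow_atTop hν').comp tendsto_natCast_atTop_atTop
  have h2 : Tendsto (fun n : ℕ => C * n) atTop atTop :=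
    tendsto_id.const_mul_atTop' hC
  obtain ⟨n, hn, hn1, hn2⟩ := ((h2.eventually hν).and
    ((eventually_ge_atTop 1).and (h1.eventually_gt_atTop ((C : ℝ) ^ ν)))).exists
  have hpos : (0 : ℝ) < n := by exact_mod_cast hn1
  have h3 : (n : ℝ) ^ d ≤ (C : ℝ) ^ ν * (n : ℝ) ^ ν := by
    rw [← Real.mul_rpow (by positivity) (by positivity)]
    refine le_trans (by exact_mod_cast h n) (hn.trans (by push_cast; rfl))
  have h4 : (C : ℝ) ^ ν * (n : ℝ) ^ ν < (n : ℝ) ^ (d - ν) * (n : ℝ) ^ ν := by gcongr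
  rw [← Real.rpow_add hpos, sub_add_cancel, Real.rpow_natCast] at h4
  exact absurd h3 (not_le.2 h4)

end Growth

/-! ### Finite generation and Gelfand–Kirillov dimension of the pillow. -/

section Pillow

variable {θ : ℝ}

/-- `V + V*` and `W + W*` generate `𝒪(ℙ_θ)`. -/
theorem pillow_finiteType (hθ : Irrational θ) : Algebra.FiniteType ℂ (Pillow θ) := by
  rw [← Subalgebra.fg_iff_finiteType]
  classical
  refine ⟨{Torus.even 1 0, Torus.even 0 1}, le_antisymm ?_ ?_⟩
  · rw [Algebra.adjoin_le_iff]
    intro x hx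
    simp only [Finset.coe_insert, Finset.coe_singleton, Set.mem_insert_iff,
      Set.mem_singleton_iff] at hx
    rcases hx with rfl | rfl
    · exact Torus.even_mem _ _
    · exact Torus.even_mem _ _
  · set S := Algebra.adjoin ℂ
      ((({Torus.even 1 0, Torus.even 0 1} : Finset (Torus θ)) : Set (Torus θ))) with hS
    have hV : Torus.even 1 0 ∈ S := Algebra.subset_adjoin (by simp)
    have hW : Torus.even 0 1 ∈ S := Algebra.subset_adjoin (by simp)
    have hl : ∀ p q : ℤ, q ≠ 0 → Torus.even p q ∈ S → Torus.even (p + 1) q ∈ S :=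
      fun p q hq h => Torus.even_add_one_left_mem (S := S.toSubmodule) hθ hq
        (S.mul_mem h hV) (S.mul_mem hV h)
    have hr : ∀ p q : ℤ, p ≠ 0 → Torus.even p q ∈ S → Torus.even p (q + 1) ∈ S :=
      fun p q hq h => Torus.even_add_one_right_mem (S := S.toSubmodule) hθ hq
        (S.mul_mem h hW) (S.mul_mem hW h)
    -- The symmetry `even_neg` turns a step down into a step up.
    have hl' : ∀ p q : ℤ, q ≠ 0 → Torus.even p q ∈ S → Torus.even (p - 1) q ∈ S := by
      intro p q hq h
      rw [← Torus.even_neg] at h ⊢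
      rw [show -(p - 1) = -p + 1 by ring]
      exact hl _ _ (neg_ne_zero.2 hq) h
    have hr' : ∀ p q : ℤ, p ≠ 0 → Torus.even p q ∈ S → Torus.even p (q - 1) ∈ S := by
      intro p q hp h
      rw [← Torus.even_neg] at h ⊢
      rw [show -(q - 1) = -q + 1 by ring]
      exact hr _ _ (neg_ne_zero.2 hp) h
    have key1 : ∀ p : ℤ, Torus.even p 1 ∈ S := by
      intro p
      induction p with
      | zero => exact hW
      | succ p ih => exact hl _ _ one_ne_zero ih
      | pred p ih => exact hl' _ _ one_ne_zero ih
    have key2 : ∀ p q : ℤ, p ≠ 0 → Torus.even p q ∈ S := by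
      intro p q hp
      induction q with
      | zero => exact hr' p 1 hp (key1 p)
      | succ q ih => exact hr _ _ hp ih
      | pred q ih => exact hr' _ _ hp ih
    refine Torus.pillow_le_of_even_mem (S := S.toSubmodule) fun p q => ?_
    change Torus.even p q ∈ S
    by_cases hp : p = 0
    · by_cases hq : q = 0
      · rw [hp, hq, Torus.even, neg_zero, Torus.mon_zero_zero]
        exact S.add_mem S.one_mem S.one_mem
      · rw [hp]
        -- Column `0` cannot be climbed vertically, so it is entered sideways from column `-1`.
        exact hl (-1) q hq (key2 (-1) q (by norm_num))
    · exact key2 p q hp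

theorem pillow_isAffineOfGKDim (hθ : Irrational θ) : IsAffineOfGKDim ℂ (Pillow θ) 2 := by
  refine ⟨pillow_finiteType hθ, fun V hfin hgen => ?_⟩
  set ψ : Pillow θ →ₐ[ℂ] Torus θ := (Pillow θ).val
  have hinj : Function.Injective ψ.toLinearMap := Subtype.val_injective
  -- Dimensions are counted in the torus algebra, where monomials are available; the inclusion is
  -- injective and so preserves them.
  set W : Submodule ℂ (Torus θ) := 1 ⊔ V.map ψ.toLinearMap with hW
  have hmap : ∀ n : ℕ, ((1 ⊔ V) ^ n).map ψ.toLinearMap = W ^ n := by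
    intro n
    rw [Submodule.map_pow, Submodule.map_sup, Submodule.map_one]
  have hrank : ∀ n : ℕ, Module.finrank ℂ ((1 ⊔ V) ^ n : Submodule ℂ (Pillow θ))
      = Module.finrank ℂ (W ^ n : Submodule ℂ (Torus θ)) := by
    intro n
    rw [← hmap]
    exact (Submodule.equivMapOfInjective _ hinj _).finrank_eq
  have hVfg : V.FG := (Submodule.fg_iff_finiteDimensional V).2 hfin
  obtain ⟨K, hK⟩ := Torus.exists_le_box (hVfg.map ψ.toLinearMap)
  have hbox : ∀ n : ℕ, W ^ n ≤ Torus.box θ (n * K) := fun n =>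
    (pow_le_pow_left' (sup_le (Torus.one_le_box K) hK) n).trans (Torus.box_pow_le K n)
  apply le_antisymm
  · refine growthExponent_le_of_finrank_le (C := (2 * K + 1) ^ 2) (d := 2) fun n hn => ?_
    rw [hrank]
    refine (Submodule.finrank_mono (hbox n)).trans ((Torus.finrank_box_le _).trans ?_)
    rw [← mul_pow]
    exact Nat.pow_le_pow_left (by nlinarith) 2
  · obtain ⟨N₁, h₁⟩ := exists_mem_one_sup_pow hgen ⟨Torus.even 1 0, Torus.even_mem 1 0⟩
    obtain ⟨N₂, h₂⟩ := exists_mem_one_sup_pow hgen ⟨Torus.even 0 1, Torus.even_mem 0 1⟩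
    have h1W : 1 ≤ W := le_sup_left
    -- One exponent serves both generators; the `+ 1` keeps it positive.
    have hN₁ : Torus.even 1 0 ∈ W ^ (N₁ + N₂ + 1) := by
      refine pow_le_pow_right' h1W (by omega : N₁ ≤ _) ?_
      rw [← hmap]
      exact ⟨_, h₁, rfl⟩
    have hN₂ : Torus.even 0 1 ∈ W ^ (N₁ + N₂ + 1) := by
      refine pow_le_pow_right' h1W (by omega : N₂ ≤ _) ?_
      rw [← hmap]
      exact ⟨_, h₂, rfl⟩
    -- For `p, q < m` the element `even (p + 1) (q + 1)` is a combination of words of length `p + q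
    -- + 2 ≤ 2m` in `W ^ (N₁ + N₂ + 1)`.
    refine le_growthExponent_of_le_finrank (C := (N₁ + N₂ + 1) * 2) (d := 2) (by omega)
      fun m => ?_
    rw [hrank]
    -- Needed because `finrank` is `0` on infinite-dimensional spaces, where monotonicity would
    -- fail.
    have hfd : FiniteDimensional ℂ (W ^ ((N₁ + N₂ + 1) * 2 * m) : Submodule ℂ (Torus θ)) :=
      Submodule.finiteDimensional_of_le (hbox _)
    have hcard := finrank_span_eq_card (Torus.linearIndependent_even (θ := θ) m)
    rw [Fintype.card_prod, Fintype.card_fin, ← pow_two] at hcard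
    rw [← hcard]
    refine Submodule.finrank_mono (Submodule.span_le.2 ?_)
    rintro _ ⟨x, rfl⟩
    have h := Torus.even_mem_pow hθ hN₁ hN₂ x.1 x.2
    rw [← pow_mul] at h
    refine pow_le_pow_right' h1W ?_ h
    rw [mul_assoc]
    exact Nat.mul_le_mul_left _ (by omega)

end Pillow

theorem theorem3p2 (θ : ℝ) (hθ : Irrational θ) :
    (pillowCalculus θ).IsCalculus ∧
    (pillowCalculus θ).HasDimension 2 ∧
    (pillowCalculus θ).IsConnected ∧
    (pillowCalculus θ).IsIntegrable 2 ∧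
    IsAffineOfGKDim ℂ (Pillow θ) 2 ∧
    IsDifferentiallySmooth ℂ (Pillow θ) :=
  ⟨pillowCalculus_isCalculus hθ, pillowCalculus_hasDimension θ, pillowCalculus_isConnected θ,
    pillowCalculus_isIntegrable hθ, pillow_isAffineOfGKDim hθ,
    2, pillow_isAffineOfGKDim hθ, pillowCalculus θ, pillowCalculus_isCalculus hθ,
    pillowCalculus_hasDimension θ, pillowCalculus_isConnected θ, pillowCalculus_isIntegrable hθ⟩
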